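/- Let $n\ge 2$ and write $i^*=2n+1-i$ for $1\le i\le 2n$. Let $S^*_{2n}\subset S_{2n}$ be the group of permutations $\sigma$ of $\{1,\dots,2n\}$ with $\sigma(i^*)=\sigma(i)^*$ for all $i$, and let $S^\circ_{2n}\subset S^*_{2n}$ be the subgroup of those that are even in $S_{2n}$. Identify $\mathbb Z^n$ and $\mathbb R^n$ with the vectors $x$ of length $2n$ satisfying $x_{i^*}=-x_i$, via $(x_1,\dots,x_n)\mapsto(x_1,\dots,x_n,-x_n,\dots,-x_1)$; then $S^*_{2n}$ acts by permuting entries. Let $\widetilde W_{2n}=\mathbb Z^n\rtimes S^*_{2n}$ be the Iwahori–Weyl group of the split group $O_{2n}$. Its elements $w=t_\nu\sigma$, with translation part $t_\nu$ and linear part $\sigma$, act on $\mathbb R^n$ by $x\mapsto \nu+\sigma x$; $w$ is a translation element if $\sigma=1$. Let $Q^\vee\subset\mathbb Z^n$ be the lattice of vectors $(x_1,\dots,x_n)$ with even sum, and let $W_{\mathrm a}=Q^\vee\rtimes S^\circ_{2n}$ be the affine Weyl group. The affine roots are, up to sign, the functions $\widetilde\alpha(x)=x_i-x_j-d$ with $1\le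 i<j\le 2n$, $j\ne i^*$, $d\in\mathbb Z$; the attached affine reflection $s_{\widetilde\alpha}\in W_{\mathrm a}$ is $x\mapsto x-\widetilde\alpha(x)\,(e_i-e_j+e_{j^*}-e_{i^*})$. Let $A=\{x\in\mathbb R^n: 0<x_i-x_j<1 \text{ for all } i<j\le 2n,\ j\neq i^*\}$ be the base alcove, and let $\Omega\subset\widetilde W_{2n}$ be its stabilizer, so that $\widetilde W_{2n}=W_{\mathrm a}\rtimes\Omega$. The group $W_{\mathrm a}$ is a Coxeter group generated by the reflections in the walls of $A$, and its Bruhat order is extended to $\widetilde W_{2n}$ by: $x\omega\le x'\omega'$ (for $x,x'\in W_{\mathrm a}$ and $\omega,\omega'\in\Omega$) if and only if $\omega=\omega'$ and $x\le x'$. Let $\mu=(1,0,\dots,0)\in\mathbb Z^n$. An element $w\in\widetilde W_{2n}$ is $\mu$-permissible, written $w\in\mathrm{Perm}(\mu)$, if $w\equiv t_\mu \bmod W_{\mathrm a}$ and $wa-a\in\mathrm{Conv}(S^\circ_{2n}\mu)$ for all $a\in A$. It is $\mu$-admissible, written $w\in\mathrm{Adm}(\mu)$, if $w\le t_{\mu'}$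 for some $\mu'\in S^\circ_{2n}\mu$. Then: 1. If $w\in\widetilde W_{2n}$ is $\mu$-permissible and not a translation element, there exists an affine reflection $s_{\widetilde\alpha}$ such that $s_{\widetilde\alpha}w$ is $\mu$-permissible, $w<s_{\widetilde\alpha}w$ in the Bruhat order, and $w$ and $s_{\widetilde\alpha}w$ have the same translation part. 2. Consequently, $\mathrm{Perm}(\mu)\subset\mathrm{Adm}(\mu)$ in $\widetilde W_{2n}$. -/

import Mathlib

/-!
Throughout, `i* = 2n + 1 - i` on `{1, …, 2n}` is `Fin.rev` on `Fin (2 * n)`, and `ℝⁿ` (resp. `ℤⁿ`)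
is identified with the vectors `x` of length `2n` such that `x (i*) = - x i`, by means of
`(x₁, …, xₙ) ↦ (x₁, …, xₙ, -xₙ, …, -x₁)`.
-/

namespace EvenOrthogonal

/-- The cocharacter lattice `X_*`, that is, `ℤⁿ` seen inside `ℤ²ⁿ`. -/
def Cochar (n : ℕ) : AddSubgroup (Fin (2 * n) → ℤ) where
  carrier := {x | ∀ i, x i.rev = - x i}
  zero_mem' := by intro i; simp
  add_mem' := by
    intro x y hx hy i
    have h1 := hx i
    have h2 := hy i
    simp only [Pi.add_apply, h1, h2]
    ring
  neg_mem' := by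
    intro x hx i
    have h1 := hx i
    simp only [Pi.neg_apply, h1]

/-- The real vector space `V = X_* ⊗ ℝ`, that is, `ℝⁿ` seen inside `ℝ²ⁿ`. -/
def V (n : ℕ) : Set (Fin (2 * n) → ℝ) := {x | ∀ i, x i.rev = - x i}

/-- The group `S*_{2n}` of the permutations `σ` with `σ (i*) = (σ i)*`. -/
def StarPerm (n : ℕ) : Subgroup (Equiv.Perm (Fin (2 * n))) where
  carrier := {σ | ∀ i, σ i.rev = (σ i).rev}
  one_mem' := by intro i; rfl
  mul_mem' := by
    intro σ τ hσ hτ i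
    have h1 := hτ i
    have h2 := hσ (τ i)
    simp only [Equiv.Perm.mul_apply, h1, h2]
  inv_mem' := by
    intro σ hσ i
    have h1 := hσ (σ⁻¹ i)
    rw [Equiv.Perm.inv_eq_iff_eq, h1]
    simp

/-- The subgroup `S°_{2n}` of the elements of `S*_{2n}` that are even in `S_{2n}`. -/
def EvenStarPerm (n : ℕ) : Subgroup (StarPerm n) :=
  (Equiv.Perm.sign.comp (StarPerm n).subtype).ker

/-- `S*_{2n}` acts on `X_*` by permuting the entries: `(σ x) (i) = x (σ⁻¹ i)`. -/
def permCochar {n : ℕ} (σ : StarPerm n) (x : Cochar n) : Cochar n :=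
  ⟨fun i => (x : Fin (2 * n) → ℤ) ((σ : Equiv.Perm (Fin (2 * n)))⁻¹ i), by
    intro i
    have h1 := (StarPerm n).inv_mem σ.2 i
    have h2 := x.2 ((σ : Equiv.Perm (Fin (2 * n)))⁻¹ i)
    simp only [h1, h2]⟩

/-- The action of `S*_{2n}` on `X_*`, with `X_*` written multiplicatively. -/
def actionHom (n : ℕ) : StarPerm n →* MulAut (Multiplicative (Cochar n)) where
  toFun σ :=
    { toFun := fun x => Multiplicative.ofAdd (permCochar σ x.toAdd)
      invFun := fun x => Multiplicative.ofAdd (permCochar σ⁻¹ x.toAdd)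
      left_inv := by
        intro x
        apply Multiplicative.toAdd.injective
        apply Subtype.ext
        funext i
        simp [permCochar]
      right_inv := by
        intro x
        apply Multiplicative.toAdd.injective
        apply Subtype.ext
        funext i
        simp [permCochar]
      map_mul' := by
        intro x y
        apply Multiplicative.toAdd.injective
        apply Subtype.ext
        funext i
        simp [permCochar] }
  map_one' := by
    ext x
    rfl
  map_mul' := by
    intro σ τ
    apply MulEquiv.ext
    intro x
    apply Multiplicative.toAdd.injective
    apply Subtype.ext
    funext i
    simp [permCochar]

/-- The Iwahori-Weyl group `X_* ⋊ S*_{2n}` of the split group `O_{2n}`.  For `w = t_ν σ`,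
`w.left` is `ν` (the translation part) and `w.right` is `σ` (the linear part). -/
abbrev IwahoriWeyl (n : ℕ) : Type := Multiplicative (Cochar n) ⋊[actionHom n] StarPerm n

/-- The translation element `t_ν`. -/
def transl {n : ℕ} (ν : Cochar n) : IwahoriWeyl n := ⟨Multiplicative.ofAdd ν, 1⟩

/-- `w` is a translation element. -/
def IsTranslation {n : ℕ} (w : IwahoriWeyl n) : Prop := ∃ ν : Cochar n, w = transl ν

/-- The action of `w = t_ν σ` by affine transformations, `w x = ν + σ x`. -/
def act {n : ℕ} (w : IwahoriWeyl n) (x : Fin (2 * n) → ℝ) : Fin (2 * n) → ℝ := fun i =>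
  (((w.left.toAdd : Cochar n) : Fin (2 * n) → ℤ) i : ℝ) +
    x ((w.right : Equiv.Perm (Fin (2 * n)))⁻¹ i)

/-- The coroot lattice `Q^∨`: the elements `(x₁, …, xₙ)` of `ℤⁿ` with even sum. -/
def corootLattice (n : ℕ) : AddSubgroup (Cochar n) where
  carrier := {x | Even (∑ i : Fin n,
    (x : Fin (2 * n) → ℤ) (Fin.castLE (Nat.le_mul_of_pos_left n two_pos) i))}
  zero_mem' := by simp
  add_mem' := by
    intro x y hx hy
    simpa [Finset.sum_add_distrib] using hx.add hy
  neg_mem' := by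
    intro x hx
    simpa using hx

theorem mem_corootLattice_iff {n : ℕ} (x : Cochar n) :
    x ∈ corootLattice n ↔ (4 : ℤ) ∣ ∑ k, (x : Fin (2 * n) → ℤ) k ^ 2 := by
  obtain ⟨f, hf⟩ := x
  change Even (∑ i : Fin n, f (Fin.castLE (Nat.le_mul_of_pos_left n two_pos) i)) ↔
    (4 : ℤ) ∣ ∑ k, f k ^ 2
  have h1 : ∑ k, f k ^ 2 =
      2 * ∑ i : Fin n, f (Fin.castLE (Nat.le_mul_of_pos_left n two_pos) i) ^ 2 := by
    rw [← Equiv.sum_comp (finCongr (two_mul n).symm), Fin.sum_univ_add,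
      two_mul (∑ i : Fin n, f (Fin.castLE (Nat.le_mul_of_pos_left n two_pos) i) ^ 2)]
    congr 1
    rw [← Equiv.sum_comp Fin.revPerm]
    refine Finset.sum_congr rfl fun i _ => ?_
    have h2 : finCongr (two_mul n).symm (Fin.natAdd n (Fin.revPerm i)) =
        (Fin.castLE (Nat.le_mul_of_pos_left n two_pos) i).rev := by
      apply Fin.ext
      simp [Fin.val_rev]
      omega
    rw [h2, hf, neg_sq]
  have h3 : Even (∑ i : Fin n, f (Fin.castLE (Nat.le_mul_of_pos_left n two_pos) i) ^ 2 -
      ∑ i : Fin n, f (Fin.castLE (Nat.le_mul_of_pos_left n two_pos) i)) := by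
    rw [← Finset.sum_sub_distrib]
    refine Finset.even_sum _ fun i _ => ?_
    have h4 := Int.even_mul_pred_self (f (Fin.castLE (Nat.le_mul_of_pos_left n two_pos) i))
    rwa [mul_sub_one, ← sq] at h4
  rw [h1]
  rw [Int.even_iff] at *
  omega

theorem corootLattice_perm {n : ℕ} (σ : StarPerm n) {x : Cochar n} (hx : x ∈ corootLattice n) :
    permCochar σ x ∈ corootLattice n := by
  rw [mem_corootLattice_iff] at hx ⊢
  have h1 := Equiv.sum_comp (σ : Equiv.Perm (Fin (2 * n)))⁻¹
    (fun k => (x : Fin (2 * n) → ℤ) k ^ 2)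
  rw [← h1] at hx
  exact hx

/-- The affine Weyl group `W_a = Q^∨ ⋊ S°_{2n}`. -/
def affineWeyl (n : ℕ) : Subgroup (IwahoriWeyl n) where
  carrier := {w | w.left.toAdd ∈ corootLattice n ∧ w.right ∈ EvenStarPerm n}
  one_mem' := ⟨(corootLattice n).zero_mem, (EvenStarPerm n).one_mem⟩
  mul_mem' := by
    intro a b ha hb
    exact ⟨(corootLattice n).add_mem ha.1 (corootLattice_perm a.right hb.1),
      (EvenStarPerm n).mul_mem ha.2 hb.2⟩
  inv_mem' := by
    intro a ha
    exact ⟨corootLattice_perm a.right⁻¹ ((corootLattice n).neg_mem ha.1),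
      (EvenStarPerm n).inv_mem ha.2⟩

/-- The affine root `x ↦ x i - x j - d` of `SO_{2n}`, where `i < j` and `j ≠ i*`.
Up to sign, every affine root is of this form. -/
structure AffineRoot (n : ℕ) where
  /-- the first index -/
  i : Fin (2 * n)
  /-- the second index -/
  j : Fin (2 * n)
  lt : i < j
  ne : j ≠ i.rev
  /-- the constant term -/
  d : ℤ

theorem AffineRoot.nodup {n : ℕ} (a : AffineRoot n) : [a.i, a.j, a.i.rev, a.j.rev].Nodup := by
  have h1 := a.lt.ne
  have h2 := a.ne
  have h3 : ∀ l : Fin (2 * n), l ≠ l.rev := by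
    intro l h
    have h4 := congrArg Fin.val h
    rw [Fin.val_rev] at h4
    omega
  have h5 := h3 a.i
  have h6 := h3 a.j
  have h7 : a.i ≠ a.j.rev := fun h => h2 (by rw [h, Fin.rev_rev])
  simp [h1, h2, h5, h6, h7]

/-- The coroot `e_i - e_j + e_{j*} - e_{i*}` of the linear part of an affine root. -/
def AffineRoot.coroot {n : ℕ} (a : AffineRoot n) : Cochar n :=
  ⟨Pi.single a.i 1 - Pi.single a.j 1 + Pi.single a.j.rev 1 - Pi.single a.i.rev 1, by
    intro k
    have h : ∀ l : Fin (2 * n), (Pi.single l (1 : ℤ) : Fin (2 * n) → ℤ) k.rev =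
        (Pi.single l.rev (1 : ℤ) : Fin (2 * n) → ℤ) k := by
      intro l
      simp only [Pi.single_apply, Fin.rev_eq_iff]
    simp only [Pi.add_apply, Pi.sub_apply, h, Fin.rev_rev]
    ring⟩

/-- The linear reflection `s_α`, as the permutation `(i j)(i* j*)`. -/
def AffineRoot.linearPart {n : ℕ} (a : AffineRoot n) : StarPerm n :=
  ⟨Equiv.swap a.i a.j * Equiv.swap a.i.rev a.j.rev, by
    intro k
    have h1 : (Equiv.swap a.i a.j).Disjoint (Equiv.swap a.i.rev a.j.rev) :=
      Equiv.Perm.disjoint_swap_swap a.nodup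
    rw [Equiv.Perm.mul_apply, Equiv.Perm.mul_apply, Fin.rev_injective.map_swap,
      Fin.rev_injective.map_swap, Fin.rev_rev, Fin.rev_rev, ← Equiv.Perm.mul_apply,
      h1.commute.eq, Equiv.Perm.mul_apply]⟩

/-- The affine reflection `s`, `s x = x - (x i - x j - d) α^∨`, as the element `t_{d α^∨} s_α` of
the Iwahori-Weyl group. -/
def AffineRoot.reflection {n : ℕ} (a : AffineRoot n) : IwahoriWeyl n :=
  ⟨Multiplicative.ofAdd (a.d • a.coroot), a.linearPart⟩

theorem AffineRoot.act_reflection {n : ℕ} (a : AffineRoot n) {x : Fin (2 * n) → ℝ} (hx : x ∈ V n) :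
    act a.reflection x =
      x - (x a.i - x a.j - a.d) • (fun k => ((a.coroot : Fin (2 * n) → ℤ) k : ℝ)) := by
  funext k
  have h1 := hx a.i
  have h2 := hx a.j
  have h3 := a.nodup
  simp only [List.nodup_cons, List.mem_cons, List.not_mem_nil, or_false, not_or] at h3
  obtain ⟨⟨n1, n2, n3⟩, ⟨n4, n5⟩, n6, -⟩ := h3
  simp only [act, reflection, linearPart, coroot, toAdd_ofAdd, AddSubgroup.coe_zsmul,
    Pi.smul_apply, Pi.sub_apply, Pi.add_apply, Pi.single_apply, smul_eq_mul, mul_inv_rev,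
    Equiv.swap_inv, Equiv.Perm.mul_apply]
  by_cases k1 : k = a.i
  · subst k1
    simp [Equiv.swap_apply_of_ne_of_ne, *, Ne.symm, eq_comm]
    try ring
  by_cases k2 : k = a.j
  · subst k2
    simp [Equiv.swap_apply_of_ne_of_ne, *, Ne.symm, eq_comm]
    try ring
  by_cases k3 : k = a.i.rev
  · subst k3
    simp [Equiv.swap_apply_of_ne_of_ne, *, Ne.symm, eq_comm]
    try ring
  by_cases k4 : k = a.j.rev
  · subst k4
    simp [Equiv.swap_apply_of_ne_of_ne, *, Ne.symm, eq_comm]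
    try ring
  rw [Equiv.swap_apply_of_ne_of_ne k1 k2, Equiv.swap_apply_of_ne_of_ne k3 k4]
  simp [k1, k2, k3, k4]

/-- The reflections lie in the affine Weyl group. -/
theorem AffineRoot.reflection_mem {n : ℕ} (a : AffineRoot n) :
    a.reflection ∈ affineWeyl n := by
  have h3 := a.nodup
  simp only [List.nodup_cons, List.mem_cons, List.not_mem_nil, or_false, not_or] at h3
  obtain ⟨⟨n1, n2, n3⟩, ⟨n4, n5⟩, n6, -⟩ := h3
  constructor
  · refine (corootLattice n).zsmul_mem ?_ a.d
    rw [mem_corootLattice_iff]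
    have h4 : ∀ k, (a.coroot : Fin (2 * n) → ℤ) k ^ 2 = (if k = a.i then 1 else 0) +
        (if k = a.j then 1 else 0) + (if k = a.j.rev then 1 else 0) +
        (if k = a.i.rev then 1 else 0) := by
      intro k
      simp only [coroot, Pi.sub_apply, Pi.add_apply, Pi.single_apply]
      split_ifs <;> first | (norm_num; done) | grind
    simp [h4, Finset.sum_add_distrib]
  · change Equiv.Perm.sign (Equiv.swap a.i a.j * Equiv.swap a.i.rev a.j.rev) = 1
    rw [Equiv.Perm.sign_mul, Equiv.Perm.sign_swap n1, Equiv.Perm.sign_swap n6]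
    rfl

/-- The hyperplane in `V` on which an affine root vanishes. -/
def AffineRoot.hyperplane {n : ℕ} (a : AffineRoot n) : Set (Fin (2 * n) → ℝ) :=
  {x | x ∈ V n ∧ x a.i - x a.j = a.d}

/-- The base alcove `A`: the points of `V` at which all positive roots `x i - x j`
(`i < j`, `j ≠ i*`) take values strictly between `0` and `1`. -/
def alcove (n : ℕ) : Set (Fin (2 * n) → ℝ) :=
  {x | x ∈ V n ∧ ∀ i j : Fin (2 * n), i < j → j ≠ i.rev → 0 < x i - x j ∧ x i - x j < 1}

/-- The hyperplane of `a` is a wall of the base alcove: it contains a point of the closure of the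
alcove that lies on no other affine root hyperplane (a point inside a face of codimension one). -/
def AffineRoot.IsWall {n : ℕ} (a : AffineRoot n) : Prop :=
  ∃ x ∈ closure (alcove n), x ∈ a.hyperplane ∧
    ∀ b : AffineRoot n, x ∈ b.hyperplane → b.hyperplane = a.hyperplane

/-- The Coxeter generators of `W_a`: the reflections across the walls of the base alcove. -/
def simpleReflections (n : ℕ) : Set (affineWeyl n) :=
  {s | ∃ a : AffineRoot n, a.IsWall ∧ (s : IwahoriWeyl n) = a.reflection}

/-- The length of `g` with respect to a generating set `S`. -/
noncomputable def wordLength {G : Type*} [Group G] (S : Set G) (g : G) : ℕ :=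
  sInf {k | ∃ l : List G, (∀ s ∈ l, s ∈ S) ∧ l.prod = g ∧ l.length = k}

/-- The Bruhat order of a Coxeter group `G` with set `S` of Coxeter generators: the reflexive
transitive closure of the relations `u < r u`, where `r` is a conjugate of an element of `S`
and `r u` is longer than `u`. -/
def CoxeterBruhatLE {G : Type*} [Group G] (S : Set G) : G → G → Prop :=
  Relation.ReflTransGen fun u v =>
    ∃ s ∈ S, ∃ g : G, v = (g * s * g⁻¹) * u ∧ wordLength S u < wordLength S v

/-- The stabilizer `Ω` of the base alcove in the Iwahori-Weyl group. -/
def alcoveStabilizer (n : ℕ) : Set (IwahoriWeyl n) := {w | act w '' alcove n = alcove n}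

/-- The Bruhat order on the Iwahori-Weyl group: `x ω ≤ x' ω'` for `x, x' ∈ W_a` and `ω, ω' ∈ Ω`
if and only if `ω = ω'` and `x ≤ x'` in `W_a`. -/
def BruhatLE {n : ℕ} (w w' : IwahoriWeyl n) : Prop :=
  ∃ x x' : affineWeyl n, ∃ ω ∈ alcoveStabilizer n,
    w = (x : IwahoriWeyl n) * ω ∧ w' = (x' : IwahoriWeyl n) * ω ∧
      CoxeterBruhatLE (simpleReflections n) x x'

/-- The strict Bruhat order. -/
def BruhatLT {n : ℕ} (w w' : IwahoriWeyl n) : Prop := BruhatLE w w' ∧ w ≠ w'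

/-- The orbit of a cocharacter under the Weyl group `S°_{2n}`. -/
def weylOrbit {n : ℕ} (μ : Cochar n) : Set (Cochar n) :=
  {ν | ∃ σ ∈ EvenStarPerm n, ν = permCochar σ μ}

/-- The convex hull in `V` of the Weyl orbit of a cocharacter. -/
def orbitHull {n : ℕ} (μ : Cochar n) : Set (Fin (2 * n) → ℝ) :=
  convexHull ℝ ((fun (ν : Cochar n) (i : Fin (2 * n)) =>
    ((ν : Fin (2 * n) → ℤ) i : ℝ)) '' weylOrbit μ)

/-- The `μ`-permissible set. -/
def Perm {n : ℕ} (μ : Cochar n) : Set (IwahoriWeyl n) :=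
  {w | w * (transl μ)⁻¹ ∈ affineWeyl n ∧ ∀ a ∈ alcove n, act w a - a ∈ orbitHull μ}

/-- The `μ`-admissible set. -/
def Adm {n : ℕ} (μ : Cochar n) : Set (IwahoriWeyl n) :=
  {w | ∃ ν ∈ weylOrbit μ, BruhatLE w (transl ν)}

/-- The cocharacter `μ = (1, 0, …, 0)` of `ℤⁿ`, that is, `(1, 0, …, 0, -1)` in `ℤ²ⁿ`. -/
def mu (n : ℕ) : Cochar n :=
  ⟨fun i => if (i : ℕ) = 0 then 1 else if (i : ℕ) = 2 * n - 1 then -1 else 0, by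
    intro i
    simp only [Fin.val_rev]
    split_ifs <;> omega⟩

end EvenOrthogonal

/-! A permissible `w` has translation part `ν = e_c - e_{c*}`. Since the hull of the orbit of `μ` is
a cross-polytope, permissibility says that, with `τ` the inverse of the linear part, `∑ |ν_i + a_{τ
i} - a_i| ≤ 2` on the closed alcove. The terms at `c` and `c*` already use `2 (1 + a_{τ c} - a_c)`.
So the remaining pairs `{i, i*}`, each counted once, have only the budget `a_c - a_{τ c}` for their
total movement `∑ |a_{τ i} - a_i|`.

The reflection in `x_c - x_j = 1` fixes `ν` and replaces `τ` by `τ (c j)(c* j*)`. This root is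
negative at the base point `p` and takes the value `p_{τ c} - p_{τ j}` at `w p`, so the length grows
as soon as `p_{τ c} < p_{τ j}`. It remains to choose `j` so that the displacement bound survives
(`exists_step`). If `a_{τ c} ≤ a_{τ τ c}` on the whole alcove and `τ c ≠ c*`, then `j = τ c` works
by the triangle inequality. Otherwise, testing the budget on special points of the alcove gives `τ c
= m*` with `c ≤ m ≤ n - 2` (indices from 0), and `τ` preserves `{0, …, m}` away from `c, c*`.
Evenness of `τ` then forces some `k` with `m < k < n` to be moved. For the least such `k`, the
choice `j = k*` works, by comparison with a flattened point of the alcove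
(`displacement_doubleSwap_le_of_fixed`).

The passage from "same side of the hyperplane" to the Bruhat order rests on the exchange property,
read off from galleries of alcoves (`exists_conj_of_separates`), and on the generation of `W_a` by
the wall reflections (`mem_closure_simpleReflections`). Only finitely many elements of a coset of
`W_a` share a translation part, so repeated steps end at a translation `t_ν` with `ν` in the orbit.
-/

namespace EvenOrthogonal

/-! ### The closed base alcove and its test points -/

/-- The closure of the base alcove, given by weak inequalities. -/
def closedAlcove (n : ℕ) : Set (Fin (2 * n) → ℝ) :=
  {x | x ∈ V n ∧ ∀ i j : Fin (2 * n), i < j → j ≠ i.rev → 0 ≤ x i - x j ∧ x i - x j ≤ 1}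

/-- A point of the base alcove with pairwise distinct entries. -/
noncomputable def basePoint (n : ℕ) : Fin (2 * n) → ℝ := fun i => (2 * n - 1 - 2 * (i : ℕ)) / (4 * n)

theorem rev_ne_self {n : ℕ} (i : Fin (2 * n)) : i.rev ≠ i := by
  intro h
  have := congrArg Fin.val h
  rw [Fin.val_rev] at this
  omega

theorem basePoint_sub {n : ℕ} (i j : Fin (2 * n)) :
    basePoint n i - basePoint n j = ((j : ℕ) - (i : ℕ) : ℝ) / (2 * n) := by
  have : 0 < n := by have := i.2; omega
  have : (0 : ℝ) < n := by exact_mod_cast this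
  unfold basePoint
  field_simp
  ring

theorem basePoint_mem_V (n : ℕ) : basePoint n ∈ V n := by
  intro i
  have h : (i.rev : ℕ) + (i : ℕ) + 1 = 2 * n := by rw [Fin.val_rev]; omega
  have h' : ((i.rev : ℕ) : ℝ) = 2 * n - 1 - (i : ℕ) := by
    rw [eq_sub_iff_add_eq, eq_sub_iff_add_eq]; exact_mod_cast h
  unfold basePoint
  rw [h', ← neg_div]
  congr 1
  ring

theorem basePoint_lt_iff {n : ℕ} {i j : Fin (2 * n)} : basePoint n i < basePoint n j ↔ j < i := by
  have : 0 < n := by have := i.2; omega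
  have : (0 : ℝ) < n := by exact_mod_cast this
  rw [← sub_pos, basePoint_sub, div_pos_iff_of_pos_right (by positivity), sub_pos, Nat.cast_lt,
    Fin.lt_def]

theorem basePoint_injective (n : ℕ) : Function.Injective (basePoint n) := by
  intro i j h
  by_contra hne
  rcases lt_or_gt_of_ne hne with h' | h'
  · exact (basePoint_lt_iff.2 h').ne' h
  · exact (basePoint_lt_iff.2 h').ne h

theorem basePoint_mem_alcove (n : ℕ) : basePoint n ∈ alcove n := by
  refine ⟨basePoint_mem_V n, fun i j hij _ => ⟨sub_pos.2 (basePoint_lt_iff.2 hij), ?_⟩⟩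
  have hn : 0 < n := by have := i.2; omega
  have hn' : (0 : ℝ) < n := by exact_mod_cast hn
  rw [basePoint_sub, div_lt_one (by positivity)]
  have h1 : ((j : ℕ) : ℝ) < 2 * n := by exact_mod_cast j.2
  have h2 : (0 : ℝ) ≤ ((i : ℕ) : ℝ) := Nat.cast_nonneg _
  linarith

theorem alcove_subset_closedAlcove (n : ℕ) : alcove n ⊆ closedAlcove n := fun _ hx =>
  ⟨hx.1, fun i j h1 h2 => ⟨(hx.2 i j h1 h2).1.le, (hx.2 i j h1 h2).2.le⟩⟩

/-- Moving slightly towards the base point makes every weak inequality strict. This lets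
permissibility be tested at boundary points. -/
theorem closedAlcove_subset_closure (n : ℕ) : closedAlcove n ⊆ closure (alcove n) := by
  intro x hx
  have hp := basePoint_mem_alcove n
  have h1 : Filter.Tendsto (fun t : ℝ => (1 - t) • x + t • basePoint n)
      (nhdsWithin 0 (Set.Ioi 0)) (nhds x) := by
    have : Continuous fun t : ℝ => (1 - t) • x + t • basePoint n := by fun_prop
    simpa using (this.tendsto 0).mono_left nhdsWithin_le_nhds
  refine mem_closure_of_tendsto h1 ?_
  filter_upwards [Ioo_mem_nhdsGT (zero_lt_one (α := ℝ))] with t ht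
  refine ⟨fun i => ?_, fun i j hij hne => ?_⟩
  · simp only [Pi.add_apply, Pi.smul_apply, smul_eq_mul, hx.1 i, hp.1 i]
    ring
  · obtain ⟨a1, a2⟩ := hx.2 i j hij hne
    obtain ⟨b1, b2⟩ := hp.2 i j hij hne
    simp only [Pi.add_apply, Pi.smul_apply, smul_eq_mul]
    have e : (1 - t) * x i + t * basePoint n i - ((1 - t) * x j + t * basePoint n j) =
      (1 - t) * (x i - x j) + t * (basePoint n i - basePoint n j) := by ring
    rw [e]
    obtain ⟨t1, t2⟩ := ht
    constructor
    · have := mul_nonneg (sub_nonneg.2 t2.le) a1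
      have := mul_pos t1 b1
      linarith
    · have := mul_le_mul_of_nonneg_left a2 (sub_nonneg.2 t2.le)
      have := mul_lt_mul_of_pos_left b2 t1
      linarith

/-- An odd, nondecreasing, 1-Lipschitz change of the entries shrinks differences without reversing
them. It is later applied to a map that collapses a band of values. -/
theorem closedAlcove_comp {n : ℕ} {φ : ℝ → ℝ} (hodd : ∀ t, φ (-t) = - φ t)
    (hmono : ∀ s t, s ≤ t → 0 ≤ φ t - φ s ∧ φ t - φ s ≤ t - s) {x : Fin (2 * n) → ℝ}
    (hx : x ∈ closedAlcove n) : (fun i => φ (x i)) ∈ closedAlcove n := by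
  refine ⟨fun i => ?_, fun i j hij hne => ?_⟩
  · change φ (x i.rev) = - φ (x i)
    rw [hx.1 i, hodd]
  · obtain ⟨a1, a2⟩ := hx.2 i j hij hne
    obtain ⟨b1, b2⟩ := hmono (x j) (x i) (by linarith)
    exact ⟨b1, b2.trans a2⟩

/-- The vector with entries `1/2` on `P`, `-1/2` on the image of `P` under `i ↦ i*`, and `0`
elsewhere. -/
noncomputable def levelVec {n : ℕ} (P : Fin (2 * n) → Prop) [DecidablePred P] :
    Fin (2 * n) → ℝ := fun i => (if P i then 1 / 2 else 0) - (if P i.rev then 1 / 2 else 0)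

theorem levelVec_mem {n : ℕ} (P : Fin (2 * n) → Prop) [DecidablePred P]
    (hP : ∀ i, P i → ¬ P i.rev) (hlow : ∀ i j, i < j → j ≠ i.rev → P j → P i) :
    levelVec P ∈ closedAlcove n := by
  refine ⟨fun i => ?_, fun i j hij hne => ?_⟩
  · simp only [levelVec, Fin.rev_rev]
    ring
  · have h1 := hlow i j hij hne
    have h2 := hlow j.rev i.rev (Fin.rev_lt_rev.2 hij) (by simpa using Ne.symm (by
      intro h; exact hne (by rw [h, ])))
    have h3 := hP i
    have h4 := hP j
    simp only [levelVec]
    split_ifs <;> first | (norm_num; done) | (exfalso; tauto)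

/-- The initial segment of length `k ≤ n`, as a vector of the closed base alcove. -/
theorem levelVec_lt_mem {n k : ℕ} (hk : k ≤ n) :
    levelVec (fun i : Fin (2 * n) => (i : ℕ) < k) ∈ closedAlcove n := by
  refine levelVec_mem _ (fun i h => ?_) (fun i j hij _ h => ?_)
  · rw [Fin.val_rev]; omega
  · rw [Fin.lt_def] at hij; omega

/-- The entries `n - 1` and `n` are exchanged by `i ↦ i*`, hence not comparable in the alcove, so
`n` may take the place of `n - 1` in the first half. -/
theorem levelVec_mid_mem (n : ℕ) :
    levelVec (fun i : Fin (2 * n) => (i : ℕ) + 1 < n ∨ (i : ℕ) = n) ∈ closedAlcove n := by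
  refine levelVec_mem _ (fun i h => ?_) (fun i j hij hne h => ?_)
  · rw [Fin.val_rev]; omega
  · rw [ne_eq, Fin.ext_iff, Fin.val_rev] at hne
    rw [Fin.lt_def] at hij; omega

/-! ### Displacement and its change under a double transposition -/

/-- The vector `e_c - e_{c*}`. -/
def unitVec {n : ℕ} (c : Fin (2 * n)) : Fin (2 * n) → ℝ :=
  fun i => (if i = c then 1 else 0) - (if i = c.rev then 1 else 0)

/-- The permutation `(i j)(i* j*)`. -/
def doubleSwap {n : ℕ} (i j : Fin (2 * n)) : Equiv.Perm (Fin (2 * n)) :=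
  Equiv.swap i j * Equiv.swap i.rev j.rev

/-- The `ℓ¹`-norm (over all `2n` entries) of `wa - a`, where `w` has translation part
`e_c - e_{c*}` and linear part `τ⁻¹`. -/
noncomputable def displacement {n : ℕ} (c : Fin (2 * n)) (τ : Equiv.Perm (Fin (2 * n)))
    (a : Fin (2 * n) → ℝ) : ℝ := ∑ i, |unitVec c i + a (τ i) - a i|

theorem unitVec_rev {n : ℕ} (c i : Fin (2 * n)) : unitVec c i.rev = - unitVec c i := by
  simp only [unitVec, Fin.rev_eq_iff, Fin.rev_rev]
  ring

theorem unitVec_self {n : ℕ} (c : Fin (2 * n)) : unitVec c c = 1 := by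
  simp [unitVec, (rev_ne_self c).symm]

theorem unitVec_of_ne {n : ℕ} {c i : Fin (2 * n)} (h1 : i ≠ c) (h2 : i ≠ c.rev) :
    unitVec c i = 0 := by
  simp [unitVec, h1, h2]

theorem sum_eq_of_support {n : ℕ} {F : Fin (2 * n) → ℝ} (hF : ∀ i, F i.rev = F i)
    {c j : Fin (2 * n)} (h1 : j ≠ c) (h2 : j ≠ c.rev)
    (h0 : ∀ i, i ≠ c → i ≠ c.rev → i ≠ j → i ≠ j.rev → F i = 0) :
    ∑ i, F i = 2 * (F c + F j) := by
  have h3 : j.rev ≠ c := fun h => h2 (by rw [← h, Fin.rev_rev])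
  have e : ∑ i ∈ ({c, c.rev, j, j.rev} : Finset (Fin (2 * n))), F i = ∑ i, F i := by
    refine Finset.sum_subset (Finset.subset_univ _) fun i _ hi => ?_
    simp only [Finset.mem_insert, Finset.mem_singleton, not_or] at hi
    exact h0 i hi.1 hi.2.1 hi.2.2.1 hi.2.2.2
  rw [← e, Finset.sum_insert, Finset.sum_insert, Finset.sum_pair, hF, hF]
  · ring
  · exact (rev_ne_self j).symm
  · simp [Ne.symm h2, Ne.symm h1]
  · simp [Ne.symm h1, Ne.symm h3, (rev_ne_self c).symm]

theorem sum_pairs_le {n : ℕ} {F : Fin (2 * n) → ℝ} (hF : ∀ i, F i.rev = F i) (h0 : ∀ i, 0 ≤ F i)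
    {c i j : Fin (2 * n)} (h1 : i ≠ c) (h2 : i ≠ c.rev) (h3 : j ≠ c) (h4 : j ≠ c.rev)
    (h5 : j ≠ i) (h6 : j ≠ i.rev) : 2 * (F c + F i + F j) ≤ ∑ k, F k := by
  have h1' : i.rev ≠ c := fun h => h2 (by rw [← h, Fin.rev_rev])
  have h3' : j.rev ≠ c := fun h => h4 (by rw [← h, Fin.rev_rev])
  have h5' : j.rev ≠ i := fun h => h6 (by rw [← h, Fin.rev_rev])
  have e : ∑ k ∈ ({c, c.rev, i, i.rev, j, j.rev} : Finset (Fin (2 * n))), F k ≤ ∑ k, F k :=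
    Finset.sum_le_univ_sum_of_nonneg h0
  rw [Finset.sum_insert, Finset.sum_insert, Finset.sum_insert, Finset.sum_insert, Finset.sum_pair,
    hF, hF, hF] at e
  · linarith
  · exact (rev_ne_self j).symm
  · simp [Ne.symm h6, Ne.symm h5]
  · simp [Ne.symm h5, Ne.symm h5', (rev_ne_self i).symm]
  · simp [Ne.symm h2, Ne.symm h1, Ne.symm h3, Ne.symm h4]
  · simp [Ne.symm h1, Ne.symm h1', Ne.symm h3, Ne.symm h3', (rev_ne_self c).symm]

theorem doubleSwap_rev {n : ℕ} {i j : Fin (2 * n)} (h1 : j ≠ i) (h2 : j ≠ i.rev) (k : Fin (2 * n)) :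
    doubleSwap i j k.rev = (doubleSwap i j k).rev := by
  have h3 : j.rev ≠ i := fun h => h2 (by rw [← h, Fin.rev_rev])
  have h : (Equiv.swap i j).Disjoint (Equiv.swap i.rev j.rev) :=
    Equiv.Perm.disjoint_swap_swap (by
      simp [Ne.symm h1, h2, Ne.symm h3, (rev_ne_self i).symm, (rev_ne_self j).symm])
  unfold doubleSwap
  rw [Equiv.Perm.mul_apply, Equiv.Perm.mul_apply, Fin.rev_injective.map_swap,
      Fin.rev_injective.map_swap, Fin.rev_rev, Fin.rev_rev, ← Equiv.Perm.mul_apply,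
      h.commute.eq, Equiv.Perm.mul_apply]

theorem doubleSwap_left {n : ℕ} {i j : Fin (2 * n)} (h2 : j ≠ i.rev) : doubleSwap i j i = j := by
  have h3 : j.rev ≠ i := fun h => h2 (by rw [← h, Fin.rev_rev])
  simp [doubleSwap, Equiv.swap_apply_of_ne_of_ne (rev_ne_self i).symm h3.symm]

theorem doubleSwap_right {n : ℕ} {i j : Fin (2 * n)} (h2 : j ≠ i.rev) : doubleSwap i j j = i := by
  simp [doubleSwap, Equiv.swap_apply_of_ne_of_ne h2 (rev_ne_self j).symm]

theorem doubleSwap_of_ne {n : ℕ} {i j k : Fin (2 * n)} (h1 : k ≠ i) (h2 : k ≠ i.rev) (h3 : k ≠ j)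
    (h4 : k ≠ j.rev) : doubleSwap i j k = k := by
  simp [doubleSwap, Equiv.swap_apply_of_ne_of_ne, *]

section Step

variable {n : ℕ} {τ : Equiv.Perm (Fin (2 * n))} {c : Fin (2 * n)}

theorem summand_rev (hτ : ∀ i, τ i.rev = (τ i).rev) {a : Fin (2 * n) → ℝ} (ha : a ∈ V n)
    (i : Fin (2 * n)) :
    |unitVec c i.rev + a (τ i.rev) - a i.rev| = |unitVec c i + a (τ i) - a i| := by
  rw [unitVec_rev, hτ, ha, ha, ← abs_neg]
  congr 1
  ring

/-- Only the terms at `c`, `j` and their duals change, and dual terms are equal; hence the factor 2.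
-/
theorem displacement_doubleSwap (hτ : ∀ i, τ i.rev = (τ i).rev) {j : Fin (2 * n)} (h1 : j ≠ c)
    (h2 : j ≠ c.rev) {a : Fin (2 * n) → ℝ} (ha : a ∈ V n) :
    displacement c (τ * doubleSwap c j) a = displacement c τ a +
      2 * (|1 + a (τ j) - a c| - |1 + a (τ c) - a c| + |a (τ c) - a j| - |a (τ j) - a j|) := by
  have hτ' : ∀ i, (τ * doubleSwap c j) i.rev = ((τ * doubleSwap c j) i).rev := fun i => by
    rw [Equiv.Perm.mul_apply, doubleSwap_rev h1 h2, hτ, Equiv.Perm.mul_apply]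
  rw [← sub_eq_iff_eq_add', displacement, displacement, ← Finset.sum_sub_distrib,
    sum_eq_of_support (fun i => by rw [summand_rev hτ ha, summand_rev hτ' ha]) h1 h2]
  · rw [Equiv.Perm.mul_apply, Equiv.Perm.mul_apply, doubleSwap_left h2, doubleSwap_right h2,
      unitVec_self, unitVec_of_ne h1 h2]
    simp only [zero_add]
    ring
  · intro i i1 i2 i3 i4
    rw [Equiv.Perm.mul_apply, doubleSwap_of_ne i1 i2 i3 i4, sub_self]

/-- The budget inequality: the terms at `c` and `c*` are each at least `1 + a (τ c) - a c`, which
leaves `a c - a (τ c)` for the other pairs. The next two lemmas are the versions with no pair and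
with one pair. -/
theorem abs_add_abs_le (hτ : ∀ i, τ i.rev = (τ i).rev) {a : Fin (2 * n) → ℝ} (ha : a ∈ V n)
    (h : displacement c τ a ≤ 2) {i j : Fin (2 * n)} (h1 : i ≠ c) (h2 : i ≠ c.rev) (h3 : j ≠ c)
    (h4 : j ≠ c.rev) (h5 : j ≠ i) (h6 : j ≠ i.rev) :
    |a (τ i) - a i| + |a (τ j) - a j| ≤ a c - a (τ c) := by
  have e := sum_pairs_le (F := fun i => |unitVec c i + a (τ i) - a i|) (summand_rev hτ ha)
    (fun _ => abs_nonneg _) h1 h2 h3 h4 h5 h6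
  beta_reduce at e
  rw [unitVec_self, unitVec_of_ne h1 h2, unitVec_of_ne h3 h4, zero_add, zero_add] at e
  have := le_abs_self (1 + a (τ c) - a c)
  have := e.trans h
  linarith

theorem le_of_displacement (hτ : ∀ i, τ i.rev = (τ i).rev) {a : Fin (2 * n) → ℝ} (ha : a ∈ V n)
    (h : displacement c τ a ≤ 2) : a (τ c) ≤ a c := by
  have e : ∑ i ∈ ({c, c.rev} : Finset (Fin (2 * n))), |unitVec c i + a (τ i) - a i| ≤ 2 :=
    (Finset.sum_le_univ_sum_of_nonneg fun _ => abs_nonneg _).trans h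
  rw [Finset.sum_pair (rev_ne_self c).symm, summand_rev hτ ha, unitVec_self] at e
  have := le_abs_self (1 + a (τ c) - a c)
  linarith

theorem abs_le_of_displacement (hτ : ∀ i, τ i.rev = (τ i).rev) {a : Fin (2 * n) → ℝ} (ha : a ∈ V n)
    (h : displacement c τ a ≤ 2) {i : Fin (2 * n)} (h1 : i ≠ c) (h2 : i ≠ c.rev) :
    |a (τ i) - a i| ≤ a c - a (τ c) := by
  have h1' : i.rev ≠ c := fun h => h2 (by rw [← h, Fin.rev_rev])
  have e : ∑ k ∈ ({c, c.rev, i, i.rev} : Finset (Fin (2 * n))), |unitVec c k + a (τ k) - a k| ≤ 2 :=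
    (Finset.sum_le_univ_sum_of_nonneg fun _ => abs_nonneg _).trans h
  rw [Finset.sum_insert, Finset.sum_insert, Finset.sum_pair, summand_rev hτ ha, summand_rev hτ ha,
    unitVec_self, unitVec_of_ne h1 h2, zero_add] at e
  · have := le_abs_self (1 + a (τ c) - a c)
    linarith
  · exact (rev_ne_self i).symm
  · simp [Ne.symm h2, Ne.symm h1]
  · simp [Ne.symm h1, Ne.symm h1', (rev_ne_self c).symm]

/-- If `c` were fixed the budget would be zero, and at a point with distinct entries nothing could
move. -/
theorem apply_ne_self_of_displacement (hτ : ∀ i, τ i.rev = (τ i).rev) (hτ1 : τ ≠ 1)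
    (H : ∀ a ∈ closedAlcove n, displacement c τ a ≤ 2) : τ c ≠ c := by
  intro hc
  apply hτ1
  ext1 i
  by_cases h1 : i = c
  · rw [h1, hc, Equiv.Perm.one_apply]
  by_cases h2 : i = c.rev
  · rw [h2, hτ, hc, Equiv.Perm.one_apply]
  have hp := alcove_subset_closedAlcove n (basePoint_mem_alcove n)
  have := abs_le_of_displacement hτ hp.1 (H _ hp) h1 h2
  rw [hc, sub_self, abs_nonpos_iff, sub_eq_zero] at this
  exact basePoint_injective n this

/-- Splitting off a fixed point from the cycle of `c`. -/
theorem displacement_doubleSwap_le_of_le (hτ : ∀ i, τ i.rev = (τ i).rev) (h1 : τ c ≠ c)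
    (h2 : τ c ≠ c.rev) {a : Fin (2 * n) → ℝ} (ha : a ∈ V n) (h : displacement c τ a ≤ 2)
    (hle : a (τ c) ≤ a (τ (τ c))) : displacement c (τ * doubleSwap c (τ c)) a ≤ 2 := by
  rw [displacement_doubleSwap hτ h1 h2 ha, sub_self, abs_zero, abs_of_nonneg (sub_nonneg.2 hle)]
  have := abs_sub_abs_le_abs_sub (1 + a (τ (τ c)) - a c) (1 + a (τ c) - a c)
  rw [show 1 + a (τ (τ c)) - a c - (1 + a (τ c) - a c) = a (τ (τ c)) - a (τ c) by ring,
    abs_of_nonneg (sub_nonneg.2 hle)] at this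
  linarith

end Step

/-! ### The exceptional case `τ c = m*` and the parity argument -/

/-- Such a `ρ` is the product of its restriction to the lower half and the conjugate of that
restriction by `i ↦ i*`; the two factors have the same sign. -/
theorem sign_eq_one_of_lower_half {n : ℕ} {ρ : Equiv.Perm (Fin (2 * n))}
    (hρ : ∀ i, ρ i.rev = (ρ i).rev) (hlow : ∀ i : Fin (2 * n), (i : ℕ) < n → (ρ i : ℕ) < n) :
    Equiv.Perm.sign ρ = 1 := by
  have hlow' : ∀ i : Fin (2 * n), (ρ i : ℕ) < n ↔ (i : ℕ) < n := by
    intro i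
    refine ⟨fun h => ?_, hlow i⟩
    by_contra h'
    have h1 := hlow i.rev (by rw [Fin.val_rev]; omega)
    rw [hρ, Fin.val_rev] at h1
    omega
  set ρ₁ : Equiv.Perm (Fin (2 * n)) := Equiv.Perm.ofSubtype (ρ.subtypePerm (p := fun i : Fin (2 * n) => (i : ℕ) < n) hlow')
  have e1 : ∀ i : Fin (2 * n), (i : ℕ) < n → ρ₁ i = ρ i := fun i hi => by
    exact Equiv.Perm.ofSubtype_apply_of_mem (ρ.subtypePerm hlow') (a := i) hi
  have e2 : ∀ i : Fin (2 * n), ¬ (i : ℕ) < n → ρ₁ i = i := fun i hi => by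
    exact Equiv.Perm.ofSubtype_apply_of_not_mem (ρ.subtypePerm hlow') (a := i) hi
  have e : ρ = ρ₁ * (Fin.revPerm * ρ₁ * Fin.revPerm⁻¹) := by
    ext1 i
    have er : (Fin.revPerm⁻¹ : Equiv.Perm (Fin (2 * n))) i = i.rev := rfl
    simp only [Equiv.Perm.mul_apply, er, Fin.revPerm_apply]
    by_cases hi : (i : ℕ) < n
    · rw [e2 i.rev (by rw [Fin.val_rev]; omega), Fin.rev_rev, e1 i hi]
    · have hi' : (i.rev : ℕ) < n := by rw [Fin.val_rev]; omega
      rw [e1 i.rev hi', hρ, Fin.rev_rev, e2]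
      rwa [hlow']
  rw [e]
  simp only [map_mul, map_inv]
  rcases Int.units_eq_one_or (Equiv.Perm.sign ρ₁) with h | h <;>
  rcases Int.units_eq_one_or (Equiv.Perm.sign (Fin.revPerm : Equiv.Perm (Fin (2 * n)))) with h' | h' <;>
  rw [h, h'] <;> rfl

theorem nonneg_of_mem_closedAlcove {n : ℕ} {a : Fin (2 * n) → ℝ} (ha : a ∈ closedAlcove n)
    {i : Fin (2 * n)} (hi : (i : ℕ) + 2 ≤ n) : 0 ≤ a i := by
  have hj : (i : ℕ) + 1 < 2 * n := by omega
  set j : Fin (2 * n) := ⟨i + 1, hj⟩ with hjdef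
  have h1 := (ha.2 i j (by rw [Fin.lt_def]; simp [j]) (by
    rw [ne_eq, Fin.ext_iff, Fin.val_rev]; simp only [j]; omega)).1
  have h2 := (ha.2 i j.rev (by rw [Fin.lt_def, Fin.val_rev]; simp only [j]; omega) (by
    rw [ne_eq, Fin.rev_inj, Fin.ext_iff]; simp only [j]; omega)).1
  rw [ha.1 j] at h2
  linarith

section Step

variable {n : ℕ} {τ : Equiv.Perm (Fin (2 * n))} {c : Fin (2 * n)}

/-- Either a fixed point can be split off, or the budget at the level vectors pins down the position
of `τ c`. The last alternative records the two ways this occurs: `τ c = c*`, or `m` moves to a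
smaller index that is still at least `c`. -/
theorem forall_apply_le_or_exists_rev (hτ : ∀ i, τ i.rev = (τ i).rev)
    (H : ∀ a ∈ closedAlcove n, displacement c τ a ≤ 2) (hc : τ c ≠ c) :
    (τ c ≠ c.rev ∧ ∀ a ∈ closedAlcove n, a (τ c) ≤ a (τ (τ c))) ∨
    ∃ m : Fin (2 * n), (m : ℕ) + 2 ≤ n ∧ τ c = m.rev ∧ (m = c ∨ c ≤ τ m ∧ τ m < m) := by
  have hmid := levelVec_mid_mem n
  have hlev := fun {k : ℕ} (hk : k ≤ n) => levelVec_lt_mem hk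
  by_cases hcr : τ c = c.rev
  · refine Or.inr ⟨c, ?_, hcr, Or.inl rfl⟩
    -- Here `a c* ≤ a c`, so the entry at `c` is nonnegative; the two half-integral test points then
    -- exclude `c ≥ n` and `c = n - 1`.
    have h1 := le_of_displacement hτ hmid.1 (H _ hmid)
    have h2 := le_of_displacement hτ (hlev le_rfl).1 (H _ (hlev le_rfl))
    rw [hcr] at h1 h2
    simp only [levelVec, Fin.rev_rev, Fin.val_rev] at h1 h2
    split_ifs at h1 h2 <;> first | omega | (norm_num at h1; done) | norm_num at h2
  by_cases hall : ∀ a ∈ closedAlcove n, a (τ c) ≤ a (τ (τ c))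
  · exact Or.inl ⟨hcr, hall⟩
  right
  push Not at hall
  obtain ⟨a, ha, hlt⟩ := hall
  have hmove := fun (v : Fin (2 * n) → ℝ) (hv : v ∈ closedAlcove n) =>
    abs_le_of_displacement hτ hv.1 (H v hv) hc hcr
  generalize hx : τ c = x at *
  generalize hy : τ x = y at *
  have hxy : x ≠ y := by rintro rfl; exact lt_irrefl _ hlt
  by_cases hyr : y = x.rev
  · exfalso
    subst hyr
    by_cases x1 : (x : ℕ) < n
    · have h := hmove _ (hlev le_rfl)
      simp only [levelVec, Fin.rev_rev, Fin.val_rev] at h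
      rw [if_pos x1, if_neg (by omega)] at h
      norm_num at h
      split_ifs at h <;> norm_num at h
    by_cases x2 : (x : ℕ) = n
    · have h := hmove _ hmid
      simp only [levelVec, Fin.rev_rev, Fin.val_rev] at h
      rw [if_pos (Or.inr x2), if_neg (by omega)] at h
      norm_num at h
      split_ifs at h <;> norm_num at h
    · have h := nonneg_of_mem_closedAlcove ha (i := x.rev) (by rw [Fin.val_rev]; omega)
      rw [ha.1] at hlt h
      linarith
  have hlt' : x < y := by
    rcases lt_or_gt_of_ne hxy with h | h
    · exact h
    · have := (ha.2 y x h (fun h' => hyr (by rw [h', Fin.rev_rev]))).1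
      linarith
  rw [Fin.lt_def] at hlt'
  -- At the level vector ending at `x`, the entry at `x` is the maximal value `1/2`, so the budget
  -- `v c - v x` is at most 0 although `v y ≠ v x`.
  by_cases x1 : (x : ℕ) < n
  · exfalso
    have h := hmove _ (hlev (k := x + 1) x1)
    simp only [levelVec, Fin.val_rev] at h
    rw [if_neg (show ¬ (y : ℕ) < x + 1 by omega), if_pos (show (x : ℕ) < x + 1 by omega),
      if_neg (show ¬ 2 * n - (x + 1) < (x : ℕ) + 1 by omega)] at h
    split_ifs at h <;> norm_num [abs_of_neg] at h
  by_cases x2 : (x : ℕ) = n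
  · exfalso
    have h := hmove _ hmid
    simp only [levelVec, Fin.val_rev] at h
    rw [if_neg (show ¬ ((y : ℕ) + 1 < n ∨ (y : ℕ) = n) by omega), if_pos (Or.inr x2),
      if_neg (show ¬ (2 * n - (x + 1) + 1 < n ∨ 2 * n - (x + 1) = n) by omega)] at h
    split_ifs at h <;> norm_num [abs_of_neg] at h
  refine ⟨x.rev, by rw [Fin.val_rev]; omega, (Fin.rev_rev x).symm, Or.inr ?_⟩
  rw [hτ, hy]
  refine ⟨?_, by rw [Fin.lt_def, Fin.val_rev, Fin.val_rev]; omega⟩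
  -- The level vector ending at `y*`: its entries at `y` and `x` are `-1/2` and `0`, so the budget
  -- requires `1/2` at `c`, that is `c ≤ y*`.
  have h := hmove _ (hlev (k := 2 * n - (y + 1) + 1) (by omega))
  simp only [levelVec, Fin.val_rev] at h
  rw [if_neg (show ¬ (y : ℕ) < 2 * n - (y + 1) + 1 by omega), if_pos (Nat.lt_succ_self _),
    if_neg (show ¬ (x : ℕ) < 2 * n - (y + 1) + 1 by omega),
    if_neg (show ¬ 2 * n - (x + 1) < 2 * n - ((y : ℕ) + 1) + 1 by omega)] at h
  rw [Fin.le_def, Fin.val_rev]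
  by_contra hcon
  rw [if_neg (by omega)] at h
  norm_num at h
  split_ifs at h <;> norm_num at h

/-- At the level vector of length `m` the budget is exhausted: it is zero if `m = c`, and otherwise
the move of `m` from value `0` to `1/2` consumes it. So no other index changes level. Passing to
length `m + 1` alters only the entries at `m` and `m*`, which are the images of `c*` and `c`. -/
theorem level_apply_eq (hτ : ∀ i, τ i.rev = (τ i).rev)
    (H : ∀ a ∈ closedAlcove n, displacement c τ a ≤ 2) {m : Fin (2 * n)} (hm : (m : ℕ) + 2 ≤ n)
    (hcm : τ c = m.rev) (hm' : m = c ∨ c ≤ τ m ∧ τ m < m) {i : Fin (2 * n)} (h1 : i ≠ c)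
    (h2 : i ≠ c.rev) :
    levelVec (fun i : Fin (2 * n) => (i : ℕ) < m + 1) (τ i) =
      levelVec (fun i : Fin (2 * n) => (i : ℕ) < m + 1) i := by
  have hsame : ∀ k : Fin (2 * n), k ≠ m → k ≠ m.rev →
      levelVec (fun i : Fin (2 * n) => (i : ℕ) < m + 1) k =
        levelVec (fun i : Fin (2 * n) => (i : ℕ) < m) k := by
    intro k k1 k2
    rw [ne_eq, Fin.ext_iff] at k1 k2
    rw [Fin.val_rev] at k2
    simp only [levelVec, Fin.val_rev]
    congr 2 <;> rw [eq_iff_iff] <;> omega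
  have hv := levelVec_lt_mem (n := n) (k := m) (by omega)
  have hcm' : τ c.rev = m := by rw [hτ, hcm, Fin.rev_rev]
  have t1 : τ i ≠ m.rev := fun h => h1 (τ.injective (h.trans hcm.symm))
  have t2 : τ i ≠ m := fun h => h2 (τ.injective (h.trans hcm'.symm))
  have key : i ≠ m → i ≠ m.rev → levelVec (fun i : Fin (2 * n) => (i : ℕ) < m) (τ i) =
      levelVec (fun i : Fin (2 * n) => (i : ℕ) < m) i := by
    intro i1 i2
    rcases hm' with rfl | ⟨q1, q2⟩
    · have := abs_le_of_displacement hτ hv.1 (H _ hv) h1 h2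
      rw [hcm, hv.1, sub_neg_eq_add] at this
      have e : levelVec (fun i : Fin (2 * n) => (i : ℕ) < m) m = 0 := by
        simp only [levelVec, Fin.val_rev]
        rw [if_neg (lt_irrefl _), if_neg (by omega), sub_zero]
      rw [e, add_zero, abs_nonpos_iff, sub_eq_zero] at this
      exact this
    · rw [Fin.le_def] at q1
      rw [Fin.lt_def] at q2
      have m1 : m ≠ c := by rintro rfl; omega
      have m2 : m ≠ c.rev := by
        rw [ne_eq, Fin.ext_iff, Fin.val_rev]; omega
      have := abs_add_abs_le hτ hv.1 (H _ hv) m1 m2 h1 h2 i1 i2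
      rw [hcm, hv.1] at this
      have e : levelVec (fun i : Fin (2 * n) => (i : ℕ) < m) m = 0 := by
        simp only [levelVec, Fin.val_rev]
        rw [if_neg (lt_irrefl _), if_neg (by omega), sub_zero]
      have e1 : levelVec (fun i : Fin (2 * n) => (i : ℕ) < m) c = 1 / 2 := by
        simp only [levelVec, Fin.val_rev]
        rw [if_pos (by omega), if_neg (by omega), sub_zero]
      have e2 : levelVec (fun i : Fin (2 * n) => (i : ℕ) < m) (τ m) = 1 / 2 := by
        simp only [levelVec, Fin.val_rev]
        rw [if_pos (by omega), if_neg (by omega), sub_zero]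
      rw [e, e1, e2] at this
      have h3 : |levelVec (fun i : Fin (2 * n) => (i : ℕ) < m) (τ i) -
        levelVec (fun i : Fin (2 * n) => (i : ℕ) < m) i| ≤ 0 := by
          rw [show |(1 / 2 : ℝ) - 0| = 1 / 2 by norm_num [abs_of_pos]] at this
          linarith
      rw [abs_nonpos_iff, sub_eq_zero] at h3
      exact h3
  by_cases i1 : i = m
  · rcases hm' with rfl | ⟨q1, q2⟩
    · exact absurd i1 h1
    rw [i1]
    rw [Fin.lt_def] at q2
    simp only [levelVec, Fin.val_rev]
    rw [if_pos (by omega), if_neg (by omega), if_pos (by omega), if_neg (by omega)]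
  by_cases i2 : i = m.rev
  · rcases hm' with rfl | ⟨q1, q2⟩
    · exact absurd i2 h2
    rw [i2, hτ, (levelVec_lt_mem (n := n) (k := m + 1) (by omega)).1,
      (levelVec_lt_mem (n := n) (k := m + 1) (by omega)).1]
    rw [Fin.lt_def] at q2
    simp only [levelVec, Fin.val_rev]
    rw [if_pos (by omega), if_neg (by omega), if_pos (by omega), if_neg (by omega)]
  rw [hsame i i1 i2, hsame _ t2 t1, key i1 i2]

theorem apply_le_iff (hτ : ∀ i, τ i.rev = (τ i).rev)
    (H : ∀ a ∈ closedAlcove n, displacement c τ a ≤ 2) {m : Fin (2 * n)} (hm : (m : ℕ) + 2 ≤ n)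
    (hcm : τ c = m.rev) (hm' : m = c ∨ c ≤ τ m ∧ τ m < m) {i : Fin (2 * n)} (h1 : i ≠ c)
    (h2 : i ≠ c.rev) : τ i ≤ m ↔ i ≤ m := by
  have h := level_apply_eq hτ H hm hcm hm' h1 h2
  simp only [levelVec, Fin.val_rev] at h
  rw [Fin.le_def, Fin.le_def]
  have := (τ i).2
  have := i.2
  split_ifs at h <;> first | omega | (exfalso; norm_num at h)

theorem exists_not_fixed (hτ : ∀ i, τ i.rev = (τ i).rev) (hsign : Equiv.Perm.sign τ = 1)
    (H : ∀ a ∈ closedAlcove n, displacement c τ a ≤ 2) {m : Fin (2 * n)} (hm : (m : ℕ) + 2 ≤ n)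
    (hcm : τ c = m.rev) (hm' : m = c ∨ c ≤ τ m ∧ τ m < m) :
    ∃ k : Fin (2 * n), m < k ∧ (k : ℕ) < n ∧ τ k ≠ k := by
  by_contra! hfix
  have hcle : c ≤ m := by
    rcases hm' with h | ⟨h, h'⟩
    · exact h.symm.le
    · exact h.trans h'.le
  have hcn : (c : ℕ) < n := by rw [Fin.le_def] at hcle; omega
  -- If every index strictly between `m` and `n` were fixed, `τ` would send exactly one lower index,
  -- `c`, to the upper half. Composing with the odd transposition `(c c*)` repairs this, so `τ`
  -- would be odd.
  have h1 : Equiv.Perm.sign (τ * Equiv.swap c c.rev) = 1 := by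
    refine sign_eq_one_of_lower_half (fun i => ?_) (fun i hi => ?_)
    · rw [Equiv.Perm.mul_apply, Equiv.Perm.mul_apply, ← hτ, Fin.rev_injective.map_swap,
        Fin.rev_rev, Equiv.swap_comm]
    · rw [Equiv.Perm.mul_apply]
      by_cases h1 : i = c
      · rw [h1, Equiv.swap_apply_left, hτ, hcm, Fin.rev_rev]
        omega
      have h2 : i ≠ c.rev := by
        rw [ne_eq, Fin.ext_iff, Fin.val_rev]
        omega
      rw [Equiv.swap_apply_of_ne_of_ne h1 h2]
      by_cases h3 : i ≤ m
      · have := (apply_le_iff hτ H hm hcm hm' h1 h2).2 h3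
        rw [Fin.le_def] at this
        omega
      · rw [hfix i (not_le.1 h3) hi]
        exact hi
  rw [map_mul, hsign, Equiv.Perm.sign_swap (rev_ne_self c).symm] at h1
  exact absurd h1 (by decide)

end Step

/-! ### Flattening a point of the alcove and merging cycles -/

/-- The truncation of `t` to the interval `[-r, r]`. -/
noncomputable def clamp (r t : ℝ) : ℝ := max (-r) (min t r)

theorem clamp_neg {r : ℝ} (hr : 0 ≤ r) (t : ℝ) : clamp r (-t) = - clamp r t := by
  unfold clamp
  rcases le_total t r with h1 | h1 <;> rcases le_total (-r) t with h2 | h2 <;>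
  rcases le_total (-t) r with h3 | h3 <;> rcases le_total (-r) (-t) with h4 | h4 <;>
  simp only [min_eq_left, min_eq_right, max_eq_left, max_eq_right, h1, h2, h3, h4,
    show -r ≤ r by linarith, neg_neg] <;> linarith

/-- The difference of truncations measures the signed part of `t` in the band `h ≤ |t| ≤ H`.
Subtracting it from `t` therefore leaves a nondecreasing 1-Lipschitz function. -/
theorem clamp_sub_clamp {h H : ℝ} (h0 : 0 ≤ h) (hH : h ≤ H) {s t : ℝ} (hst : s ≤ t) :
    0 ≤ (clamp H t - clamp h t) - (clamp H s - clamp h s) ∧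
      (clamp H t - clamp h t) - (clamp H s - clamp h s) ≤ t - s := by
  unfold clamp
  simp only [max_def, min_def]
  constructor <;> split_ifs <;> linarith

section Step

variable {n : ℕ} {τ : Equiv.Perm (Fin (2 * n))} {c : Fin (2 * n)}

/-- A perturbation that is `τ`-invariant away from `c, c*` cancels in all terms except those two. -/
theorem displacement_diff (hτ : ∀ i, τ i.rev = (τ i).rev) {a e : Fin (2 * n) → ℝ} (ha : a ∈ V n)
    (he : e ∈ V n) (hfix : ∀ i, i ≠ c → i ≠ c.rev → e (τ i) = e i) :
    displacement c τ a - 2 * |1 + a (τ c) - a c| =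
      displacement c τ (a - e) - 2 * |1 + (a - e) (τ c) - (a - e) c| := by
  have hae : a - e ∈ V n := fun i => by
    simp only [Pi.sub_apply, ha i, he i]
    ring
  have h : ∀ b ∈ V n, displacement c τ b - 2 * |1 + b (τ c) - b c| =
      ∑ i ∈ ({c, c.rev} : Finset (Fin (2 * n)))ᶜ, |unitVec c i + b (τ i) - b i| := by
    intro b hb
    rw [displacement, ← Finset.sum_add_sum_compl ({c, c.rev} : Finset (Fin (2 * n))),
      Finset.sum_pair (rev_ne_self c).symm, summand_rev hτ hb, unitVec_self]
    ring
  rw [h a ha, h _ hae]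
  refine Finset.sum_congr rfl fun i hi => ?_
  simp only [Finset.mem_compl, Finset.mem_insert, Finset.mem_singleton, not_or] at hi
  simp only [Pi.sub_apply, hfix i hi.1 hi.2]
  congr 1
  ring

/-- Merging the cycle of `c` with the cycle of another index. -/
theorem displacement_doubleSwap_le_of_fixed (hτ : ∀ i, τ i.rev = (τ i).rev)
    (H : ∀ a ∈ closedAlcove n, displacement c τ a ≤ 2) {m k : Fin (2 * n)}
    (hcle : c ≤ m) (hcm : τ c = m.rev)
    (hle : ∀ i, i ≠ c → i ≠ c.rev → (τ i ≤ m ↔ i ≤ m))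
    (hmk : m < k) (hkn : (k : ℕ) < n) (hk : τ k ≠ k) (hfix : ∀ i, m < i → i < k → τ i = i)
    {a : Fin (2 * n) → ℝ} (ha : a ∈ closedAlcove n) :
    displacement c (τ * doubleSwap c k.rev) a ≤ 2 := by
  rw [Fin.le_def] at hcle
  rw [Fin.lt_def] at hmk
  have hrange : ∀ i, k ≤ i → i ≤ k.rev → k ≤ τ i ∧ τ i ≤ k.rev := by
    have h1 : ∀ i, k ≤ i → i ≤ k.rev → k ≤ τ i := by
      intro i i1 i2
      rw [Fin.le_def] at i1 i2
      rw [Fin.val_rev] at i2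
      have c1 : i ≠ c := by rw [ne_eq, Fin.ext_iff]; omega
      have c2 : i ≠ c.rev := by rw [ne_eq, Fin.ext_iff, Fin.val_rev]; omega
      by_contra hcon
      have h3 : ¬ τ i ≤ m := by
        rw [hle i c1 c2, Fin.le_def]
        omega
      have h4 := hfix (τ i) (not_le.1 h3) (not_le.1 hcon)
      have h5 := τ.injective h4
      rw [h5, Fin.le_def] at hcon
      omega
    intro i i1 i2
    refine ⟨h1 i i1 i2, ?_⟩
    have := h1 i.rev (by rw [← Fin.rev_le_rev, Fin.rev_rev]; exact i2) (Fin.rev_le_rev.2 i1)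
    rw [hτ, ← Fin.rev_le_rev, Fin.rev_rev] at this
    exact this
  have kk : k ≤ k.rev := by rw [Fin.le_def, Fin.val_rev]; omega
  obtain ⟨hk1, hk2⟩ := hrange k le_rfl kk
  -- The indices `k` and `k*` are not comparable, so `a k` alone need not bound `a` on `[k, k*]`. As
  -- `τ k ≠ k` lies in this interval, the maximum with `a (τ k)` does.
  set h := max (a k) (a (τ k)) with hh
  have bound : ∀ i, k ≤ i → i ≤ k.rev → a i ≤ h := by
    intro i i1 i2
    by_cases e1 : i = k
    · rw [e1]; exact le_max_left _ _
    by_cases e2 : i = k.rev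
    · by_cases e3 : τ k = k.rev
      · rw [e2, ← e3]; exact le_max_right _ _
      · have := (ha.2 (τ k) k.rev (lt_of_le_of_ne hk2 e3) (by
          rw [ne_eq, Fin.rev_inj]; exact Ne.symm hk)).1
        rw [e2]
        exact le_max_of_le_right (by linarith)
    · have := (ha.2 k i (lt_of_le_of_ne i1 (Ne.symm e1)) e2).1
      exact le_max_of_le_left (by linarith)
  have bound' : ∀ i, k ≤ i → i ≤ k.rev → -h ≤ a i := by
    intro i i1 i2
    have := bound i.rev (by rw [← Fin.rev_le_rev, Fin.rev_rev]; exact i2) (Fin.rev_le_rev.2 i1)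
    rw [ha.1] at this
    linarith
  have h0 : 0 ≤ h := by
    have := bound k le_rfl kk
    have := bound' k le_rfl kk
    linarith
  have mid : ∀ i, k ≤ i → i ≤ k.rev → a i ≤ a m := by
    intro i i1 i2
    rw [Fin.le_def] at i1 i2
    rw [Fin.val_rev] at i2
    have := (ha.2 m i (by rw [Fin.lt_def]; omega) (by
      rw [ne_eq, Fin.ext_iff, Fin.val_rev]; omega)).1
    linarith
  have hH : h ≤ a m := max_le (mid k le_rfl kk) (mid _ hk1 hk2)
  -- Subtracting `e` collapses the band between `h` and `a m`. It is constant on `i ≤ m` and zero on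
  -- `[k, k*]`, and `τ` fixes the indices between, so `e` is `τ`-invariant away from `c, c*`.
  set e : Fin (2 * n) → ℝ := fun i => clamp (a m) (a i) - clamp h (a i) with he
  have hodd : ∀ t, clamp (a m) (-t) - clamp h (-t) = -(clamp (a m) t - clamp h t) := fun t => by
    rw [clamp_neg h0, clamp_neg (h0.trans hH)]
    ring
  have heV : e ∈ V n := fun i => by
    simp only [he, ha.1 i, hodd]
  have hae : a - e ∈ closedAlcove n := by
    refine closedAlcove_comp (φ := fun t => t - (clamp (a m) t - clamp h t)) (fun t => ?_)
      (fun s t hst => ?_) ha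
    · rw [hodd]; ring
    · obtain ⟨u1, u2⟩ := clamp_sub_clamp h0 hH hst
      constructor <;> linarith
  have eout : ∀ i, i ≤ m → e i = a m - h := by
    intro i hi
    have : a m ≤ a i := by
      rcases hi.eq_or_lt with rfl | hlt
      · exact le_rfl
      · have := (ha.2 i m hlt (by rw [ne_eq, Fin.ext_iff, Fin.val_rev]; omega)).1
        linarith
    simp only [he, clamp]
    rw [min_eq_right this, min_eq_right (hH.trans this), max_eq_right, max_eq_right] <;> linarith
  have ein : ∀ i, k ≤ i → i ≤ k.rev → e i = 0 := by
    intro i i1 i2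
    have b1 := bound i i1 i2
    have b2 := bound' i i1 i2
    simp only [he, clamp]
    rw [min_eq_left b1, min_eq_left (b1.trans hH), max_eq_right b2, max_eq_right, sub_self]
    linarith
  have efix : ∀ i, i ≠ c → i ≠ c.rev → e (τ i) = e i := by
    have main : ∀ i, i ≠ c → i ≠ c.rev → i ≤ k.rev → e (τ i) = e i := by
      intro i c1 c2 i2
      by_cases i1 : i ≤ m
      · rw [eout i i1, eout _ ((hle i c1 c2).2 i1)]
      by_cases i3 : i < k
      · rw [hfix i (not_le.1 i1) i3]
      · obtain ⟨r1, r2⟩ := hrange i (not_lt.1 i3) i2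
        rw [ein i (not_lt.1 i3) i2, ein _ r1 r2]
    intro i c1 c2
    by_cases i2 : i ≤ k.rev
    · exact main i c1 c2 i2
    · have := main i.rev (fun h => c2 (by rw [← h, Fin.rev_rev])) (fun h => c1 (Fin.rev_inj.1 h)) (by
        rw [Fin.le_def, Fin.val_rev] at i2
        rw [Fin.le_def, Fin.val_rev, Fin.val_rev]
        omega)
      rw [hτ, heV, heV] at this
      linarith
  have hd := displacement_diff hτ ha.1 heV efix
  have hd' := H _ hae
  have hec : e c = a m - h := eout c hcle
  have hec' : e (τ c) = -(a m - h) := by rw [hcm, heV, eout m le_rfl]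
  have hac : a (τ c) = - a m := by rw [hcm, ha.1]
  have hle' := neg_abs_le (1 + (a - e) (τ c) - (a - e) c)
  have hle2 := le_abs_self (1 + (a - e) (τ c) - (a - e) c)
  simp only [Pi.sub_apply, hec, hec', hac] at hd hle' hle2
  have hHa := H a ha
  have k1 : k.rev ≠ c := by rw [ne_eq, Fin.ext_iff, Fin.val_rev]; omega
  have k2 : k.rev ≠ c.rev := by rw [ne_eq, Fin.rev_inj, Fin.ext_iff]; omega
  rw [displacement_doubleSwap hτ k1 k2 ha.1, hτ, ha.1, ha.1, hac]
  have z1 := mid k le_rfl kk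
  have z2 := mid _ hk1 hk2
  rw [abs_of_nonpos (show - a m - - a k ≤ 0 by linarith)]
  have hmin : |-a (τ k) - - a k| = 2 * h - a k - a (τ k) := by
    rw [hh]
    rcases le_total (a k) (a (τ k)) with q | q
    · rw [max_eq_right q, abs_of_nonpos (by linarith)]; ring
    · rw [max_eq_left q, abs_of_nonneg (by linarith)]; ring
  rw [hmin]
  have hlast := abs_sub_abs_le_abs_sub (1 + - a (τ k) - a c) (1 + -a m - a c)
  rw [abs_of_nonneg (show 0 ≤ 1 + - a (τ k) - a c - (1 + -a m - a c) by linarith)] at hlast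
  have hh1 : a k ≤ h := le_max_left _ _
  have hh2 : a (τ k) ≤ h := le_max_right _ _
  -- If `1 - a (τ k) - a c` is nonnegative, the displacement bound at the flattened point `a - e`
  -- suffices; if it is negative, the bound at `a` itself does.
  rcases abs_cases (1 + - a (τ k) - a c) with ⟨q, -⟩ | ⟨q, -⟩
  · rw [q]
    linarith
  · rcases abs_cases (1 + -a m - a c) with ⟨q', -⟩ | ⟨q', -⟩ <;> linarith

theorem exists_step (hτ : ∀ i, τ i.rev = (τ i).rev) (hsign : Equiv.Perm.sign τ = 1) (hτ1 : τ ≠ 1)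
    (H : ∀ a ∈ closedAlcove n, displacement c τ a ≤ 2) :
    ∃ j, j ≠ c ∧ j ≠ c.rev ∧ basePoint n (τ c) < basePoint n (τ j) ∧
      ∀ a ∈ closedAlcove n, displacement c (τ * doubleSwap c j) a ≤ 2 := by
  have hcc := apply_ne_self_of_displacement hτ hτ1 H
  rcases forall_apply_le_or_exists_rev hτ H hcc with ⟨h1, h2⟩ | ⟨m, hm, hcm, hm'⟩
  · refine ⟨τ c, hcc, h1, lt_of_le_of_ne
      (h2 _ (alcove_subset_closedAlcove n (basePoint_mem_alcove n))) fun h => hcc ?_, fun a ha =>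
      displacement_doubleSwap_le_of_le hτ hcc h1 ha.1 (H a ha) (h2 a ha)⟩
    exact (τ.injective (basePoint_injective n h)).symm
  · have hcle : c ≤ m := by
      rcases hm' with h | ⟨h, h'⟩
      · exact h.symm.le
      · exact h.trans h'.le
    -- Minimality of `k` makes `τ` fix everything strictly between `m` and `k`, as flattening
    -- requires.
    obtain ⟨k, ⟨hk1, hk2, hk3⟩, hmin⟩ := wellFounded_lt.has_min
      {k : Fin (2 * n) | m < k ∧ (k : ℕ) < n ∧ τ k ≠ k} (exists_not_fixed hτ hsign H hm hcm hm')
    have hfix : ∀ i, m < i → i < k → τ i = i := by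
      intro i i1 i2
      by_contra hcon
      rw [Fin.lt_def] at i2
      exact hmin i ⟨i1, by omega, hcon⟩ i2
    refine ⟨k.rev, ?_, ?_, ?_, fun a ha => displacement_doubleSwap_le_of_fixed hτ H hcle hcm
      (fun i => apply_le_iff hτ H hm hcm hm') hk1 hk2 hk3 hfix ha⟩
    · rw [Fin.le_def] at hcle
      rw [ne_eq, Fin.ext_iff, Fin.val_rev]; omega
    · rw [ne_eq, Fin.rev_inj]
      exact (hcle.trans_lt hk1).ne'
    · rw [basePoint_lt_iff, hτ, hcm, Fin.rev_lt_rev]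
      rw [Fin.le_def] at hcle
      rw [Fin.lt_def] at hk1
      by_contra hcon
      have := (apply_le_iff hτ H hm hcm hm' (i := k) (by rw [ne_eq, Fin.ext_iff]; omega)
        (by rw [ne_eq, Fin.ext_iff, Fin.val_rev]; omega)).1 (not_lt.1 hcon)
      rw [Fin.le_def] at this
      omega

end Step

/-! ### The affine action, roots and reflections -/

theorem act_mul {n : ℕ} (w w' : IwahoriWeyl n) (x : Fin (2 * n) → ℝ) :
    act (w * w') x = act w (act w' x) := by
  funext i
  simp [act, actionHom, permCochar, add_assoc]

theorem act_one {n : ℕ} (x : Fin (2 * n) → ℝ) : act (1 : IwahoriWeyl n) x = x := by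
  funext i
  simp [act]

theorem act_mem_V {n : ℕ} (w : IwahoriWeyl n) {x : Fin (2 * n) → ℝ} (hx : x ∈ V n) :
    act w x ∈ V n := by
  intro i
  have h1 := (StarPerm n).inv_mem w.right.2 i
  have h2 := w.left.toAdd.2 i
  simp only [act, h1, h2, hx _, Int.cast_neg]
  ring

/-- The origin recovers the translation part, and the base point, whose entries are distinct,
recovers the linear part. -/
theorem eq_of_act_eq {n : ℕ} {w w' : IwahoriWeyl n} (h : ∀ x ∈ V n, act w x = act w' x) :
    w = w' := by
  have h0 := h 0 (fun i => by simp)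
  have hl : ∀ i, (w.left.toAdd : Fin (2 * n) → ℤ) i = (w'.left.toAdd : Fin (2 * n) → ℤ) i := by
    intro i
    have := congrFun h0 i
    simpa [act] using this
  have hp := h _ (basePoint_mem_V n)
  refine SemidirectProduct.ext (Subtype.ext (funext hl)) ?_
  rw [← inv_inj]
  refine Subtype.ext (Equiv.ext fun i => basePoint_injective n ?_)
  have := congrFun hp i
  simp only [act, hl i] at this
  exact add_left_cancel this

theorem continuous_act {n : ℕ} (w : IwahoriWeyl n) : Continuous (act w) :=
  continuous_pi fun _ => continuous_const.add (continuous_apply _)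

namespace AffineRoot

variable {n : ℕ} (a b : AffineRoot n)

/-- The value of an affine root at a point. -/
def val (x : Fin (2 * n) → ℝ) : ℝ := x a.i - x a.j - a.d

/-- The coroot of an affine root, as a real vector. -/
def realCoroot : Fin (2 * n) → ℝ := fun k => ((a.coroot : Fin (2 * n) → ℤ) k : ℝ)

theorem act_reflection_eq {x : Fin (2 * n) → ℝ} (hx : x ∈ V n) :
    act a.reflection x = x - a.val x • a.realCoroot := a.act_reflection hx

theorem continuous_val : Continuous a.val := by
  unfold val
  fun_prop

theorem mem_hyperplane_iff {x : Fin (2 * n) → ℝ} (hx : x ∈ V n) :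
    x ∈ a.hyperplane ↔ a.val x = 0 := by
  simp [hyperplane, val, hx, sub_eq_zero]

theorem realCoroot_mem : a.realCoroot ∈ V n := fun i => by
  simp only [realCoroot, a.coroot.2 i, Int.cast_neg]

theorem realCoroot_apply (k : Fin (2 * n)) :
    a.realCoroot k = unitVec k a.i - unitVec k a.j := by
  simp only [realCoroot, coroot, Pi.add_apply, Pi.sub_apply, Pi.single_apply, unitVec,
    Int.cast_add, Int.cast_sub, Int.cast_ite, Int.cast_one, Int.cast_zero, eq_comm (a := k),
    Fin.rev_eq_iff]
  ring

theorem unitVec_mem (k : Fin (2 * n)) : unitVec k ∈ V n := unitVec_rev k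

theorem unitVec_comm (k l : Fin (2 * n)) : unitVec k l = unitVec l k := by
  have h : l = k.rev ↔ k = l.rev := by rw [← Fin.rev_eq_iff, eq_comm]
  simp only [unitVec, h, eq_comm (a := k) (b := l)]

theorem sum_unitVec_mul {y : Fin (2 * n) → ℝ} (hy : y ∈ V n) (l : Fin (2 * n)) :
    ∑ k, unitVec k l * y k = 2 * y l := by
  simp only [unitVec, sub_mul, ite_mul, one_mul, zero_mul, Finset.sum_sub_distrib,
    Finset.sum_ite_eq, Finset.mem_univ, if_true, ← Fin.rev_eq_iff]
  rw [hy l]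
  ring

theorem sum_realCoroot_mul {y : Fin (2 * n) → ℝ} (hy : y ∈ V n) :
    ∑ k, a.realCoroot k * y k = 2 * (y a.i - y a.j) := by
  simp only [realCoroot_apply, sub_mul, Finset.sum_sub_distrib, sum_unitVec_mul hy]
  ring

theorem j_ne_i : a.j ≠ a.i := a.lt.ne'

theorem realCoroot_i : a.realCoroot a.i = 1 := by
  rw [realCoroot_apply, unitVec_self, unitVec_of_ne a.j_ne_i a.ne, sub_zero]

theorem realCoroot_j : a.realCoroot a.j = -1 := by
  rw [realCoroot_apply, unitVec_self, unitVec_comm, unitVec_of_ne a.j_ne_i a.ne, zero_sub]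

theorem realCoroot_eq_int (k : Fin (2 * n)) :
    a.realCoroot k = 1 ∨ a.realCoroot k = 0 ∨ a.realCoroot k = -1 := by
  have h1 : ∀ l, l ≠ k → l ≠ k.rev → unitVec k l = 0 := fun l => unitVec_of_ne
  have hi : a.i.rev ≠ a.j := a.ne.symm
  have hj : a.j.rev ≠ a.i := fun h => a.ne (by rw [← h, Fin.rev_rev])
  by_cases e1 : k = a.i
  · rw [e1, realCoroot_i]; simp
  by_cases e2 : k = a.j
  · rw [e2, realCoroot_j]; simp
  by_cases e3 : k = a.i.rev
  · rw [e3, a.realCoroot_mem, realCoroot_i]; simp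
  by_cases e4 : k = a.j.rev
  · rw [e4, a.realCoroot_mem, realCoroot_j]; simp
  · rw [realCoroot_apply, unitVec_comm, unitVec_of_ne e1 e3, unitVec_comm, unitVec_of_ne e2 e4]
    simp

theorem sq_realCoroot_sub_le (k l : Fin (2 * n)) :
    ((a.realCoroot k - a.realCoroot l) / 2) * ((a.realCoroot k - a.realCoroot l) / 2) ≤ 1 := by
  rcases a.realCoroot_eq_int k with e1 | e1 | e1 <;>
  rcases a.realCoroot_eq_int l with e2 | e2 | e2 <;> rw [e1, e2] <;> norm_num

theorem reflection_eq_of_val {ε : ℝ} (hε : ε * ε = 1) (h : ∀ x ∈ V n, b.val x = ε * a.val x) :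
    b.reflection = a.reflection := by
  have h0 := h 0 (fun i => by simp)
  have hc : b.realCoroot = ε • a.realCoroot := by
    funext k
    have := h _ (unitVec_mem k)
    simp only [val, Pi.zero_apply] at h0 this
    rw [Pi.smul_apply, realCoroot_apply, realCoroot_apply, smul_eq_mul]
    linarith
  refine eq_of_act_eq fun x hx => ?_
  rw [act_reflection_eq _ hx, act_reflection_eq _ hx, hc, h x hx, smul_smul]
  congr 2
  linear_combination a.val x * hε

theorem val_eq_of_hyperplane_eq (h : a.hyperplane = b.hyperplane) {x : Fin (2 * n) → ℝ}
    (hx : x ∈ V n) :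
    b.val x = ((a.realCoroot b.i - a.realCoroot b.j) / 2) * a.val x := by
  -- The orthogonal projection of `x` to the hyperplane of `a`, where `b` vanishes too.
  set y : Fin (2 * n) → ℝ := x - (a.val x / 2) • a.realCoroot with hy
  have hyV : y ∈ V n := fun i => by
    simp only [hy, Pi.sub_apply, Pi.smul_apply, smul_eq_mul, hx i, a.realCoroot_mem i]
    ring
  have h1 : a.val y = 0 := by
    simp only [hy, val, Pi.sub_apply, Pi.smul_apply, smul_eq_mul, realCoroot_i, realCoroot_j]
    ring
  have h2 := (b.mem_hyperplane_iff hyV).1 (h ▸ (a.mem_hyperplane_iff hyV).2 h1)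
  simp only [val, hy, Pi.sub_apply, Pi.smul_apply, smul_eq_mul] at h2 ⊢
  linarith

theorem val_pos_or_neg (x : Fin (2 * n) → ℝ) (hx : x ∈ alcove n) :
    (0 < a.val x ∧ a.d ≤ 0) ∨ (a.val x < 0 ∧ 1 ≤ a.d) := by
  obtain ⟨h1, h2⟩ := hx.2 a.i a.j a.lt a.ne
  rcases le_or_gt a.d 0 with h | h
  · have : (a.d : ℝ) ≤ 0 := by exact_mod_cast h
    exact Or.inl ⟨by unfold val; linarith, h⟩
  · have h : 1 ≤ a.d := h
    have : (1 : ℝ) ≤ a.d := by exact_mod_cast h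
    exact Or.inr ⟨by unfold val; linarith, h⟩

theorem val_mul_val_pos {x y : Fin (2 * n) → ℝ} (hx : x ∈ alcove n) (hy : y ∈ alcove n) :
    0 < a.val x * a.val y := by
  rcases a.val_pos_or_neg x hx with ⟨h1, h2⟩ | ⟨h1, h2⟩ <;>
  rcases a.val_pos_or_neg y hy with ⟨h3, h4⟩ | ⟨h3, h4⟩
  · exact mul_pos h1 h3
  · omega
  · omega
  · exact mul_pos_of_neg_of_neg h1 h3

/-- Each root is a multiple of the other. The two factors are inverse to each other and of absolute
value at most 1, so both are `1` or both are `-1`. -/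
theorem reflection_eq_of_hyperplane_eq (h : a.hyperplane = b.hyperplane) :
    b.reflection = a.reflection := by
  have h1 := fun x hx => a.val_eq_of_hyperplane_eq b h (x := x) hx
  have h2 := fun x hx => b.val_eq_of_hyperplane_eq a h.symm (x := x) hx
  have hne : a.val (basePoint n) ≠ 0 := fun h0 => by
    have := a.val_mul_val_pos (basePoint_mem_alcove n) (basePoint_mem_alcove n)
    rw [h0, zero_mul] at this
    exact lt_irrefl _ this
  have h3 := h2 _ (basePoint_mem_V n)
  rw [h1 _ (basePoint_mem_V n), ← mul_assoc] at h3
  have h4 := mul_right_cancel₀ hne ((one_mul _).trans h3)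
  refine a.reflection_eq_of_val b ?_ h1
  refine le_antisymm (a.sq_realCoroot_sub_le _ _) ?_
  have h5 := b.sq_realCoroot_sub_le a.i a.j
  set u := (a.realCoroot b.i - a.realCoroot b.j) / 2
  set v := (b.realCoroot a.i - b.realCoroot a.j) / 2
  calc (1 : ℝ) = (v * v) * (u * u) := by rw [mul_mul_mul_comm, ← h4, one_mul]
    _ ≤ 1 * (u * u) := mul_le_mul_of_nonneg_right h5 (mul_self_nonneg u)
    _ = u * u := one_mul _

/-- Precomposition with `w` permutes the affine roots up to sign; `ε = -1` when the linear part
reverses the order of the two indices. -/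
theorem exists_pullback (w : IwahoriWeyl n) :
    ∃ (b : AffineRoot n) (ε : ℝ), ε * ε = 1 ∧ (∀ x ∈ V n, a.val (act w x) = ε * b.val x) ∧
      a.reflection * w = w * b.reflection := by
  set τ : Equiv.Perm (Fin (2 * n)) := (w.right : Equiv.Perm (Fin (2 * n)))⁻¹ with hτ
  have hrev : ∀ i, τ i.rev = (τ i).rev := (StarPerm n).inv_mem w.right.2
  set ν : Fin (2 * n) → ℤ := (w.left.toAdd : Fin (2 * n) → ℤ) with hν
  have hact : ∀ x i, act w x i = ν i + x (τ i) := fun _ _ => rfl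
  have hne : τ a.i ≠ τ a.j := fun h => a.j_ne_i (τ.injective h).symm
  have hner : τ a.j ≠ (τ a.i).rev := by rw [← hrev]; exact fun h => a.ne (τ.injective h)
  obtain ⟨b, ε, hε, hb, hbc⟩ : ∃ (b : AffineRoot n) (ε : ℝ), ε * ε = 1 ∧
      (∀ x ∈ V n, a.val (act w x) = ε * b.val x) ∧
      ∀ k, b.realCoroot (τ k) = ε * a.realCoroot k := by
    have hu : ∀ k l, unitVec (τ k) (τ l) = unitVec k l := fun k l => by
      simp only [unitVec, ← hrev, τ.injective.eq_iff]
    rcases lt_or_gt_of_ne hne with h | h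
    · refine ⟨⟨τ a.i, τ a.j, h, hner, a.d - (ν a.i - ν a.j)⟩, 1, one_mul 1, fun x _ => ?_,
        fun k => ?_⟩
      · simp only [val, hact]
        push_cast
        ring
      · rw [realCoroot_apply, realCoroot_apply, hu, hu, one_mul]
    · refine ⟨⟨τ a.j, τ a.i, h, fun h => hner (by rw [h, Fin.rev_rev]),
        -(a.d - (ν a.i - ν a.j))⟩, -1, by norm_num, fun x _ => ?_, fun k => ?_⟩
      · simp only [val, hact]
        push_cast
        ring
      · rw [realCoroot_apply, realCoroot_apply, hu, hu]
        ring
  refine ⟨b, ε, hε, hb, eq_of_act_eq fun x hx => ?_⟩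
  rw [act_mul, act_mul, act_reflection_eq _ (act_mem_V w hx), act_reflection_eq _ hx, hb x hx]
  funext k
  simp only [hact, Pi.sub_apply, Pi.smul_apply, smul_eq_mul, hbc]
  ring

theorem val_act_mul_pos (w : IwahoriWeyl n) {x y : Fin (2 * n) → ℝ} (hx : x ∈ alcove n)
    (hy : y ∈ alcove n) : 0 < a.val (act w x) * a.val (act w y) := by
  obtain ⟨b, ε, hε, hb, -⟩ := a.exists_pullback w
  rw [hb x hx.1, hb y hy.1, mul_mul_mul_comm, hε, one_mul]
  exact b.val_mul_val_pos hx hy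

theorem val_act_mul_nonneg (w : IwahoriWeyl n) {x y : Fin (2 * n) → ℝ} (hx : x ∈ closure (alcove n))
    (hy : y ∈ alcove n) : 0 ≤ a.val (act w x) * a.val (act w y) := by
  have hcl : IsClosed {x | 0 ≤ a.val (act w x) * a.val (act w y)} :=
    isClosed_le continuous_const
      ((a.continuous_val.comp (continuous_act w)).mul continuous_const)
  exact closure_minimal (fun x hx => (a.val_act_mul_pos w hx hy).le) hcl hx

end AffineRoot

/-! ### Galleries and the exchange property -/

/-- If the alcoves `wA` and `wsA` lie on different sides of a hyperplane, this hyperplane is their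
common wall. -/
theorem reflection_eq_conj {n : ℕ} (a : AffineRoot n) (w : IwahoriWeyl n) {s : affineWeyl n}
    (hs : s ∈ simpleReflections n)
    (h : a.val (act w (basePoint n)) * a.val (act (w * s) (basePoint n)) < 0) :
    a.reflection * w = w * s := by
  obtain ⟨b, ⟨x, hx, hxb, hwall⟩, hsb⟩ := hs
  obtain ⟨a', ε, hε, ha', hrefl⟩ := a.exists_pullback w
  have hp := basePoint_mem_alcove n
  have hx0 : act (b.reflection) x = x := by
    rw [b.act_reflection_eq hxb.1, (b.mem_hyperplane_iff hxb.1).1 hxb, zero_smul, sub_zero]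
  rw [act_mul, ha' _ hp.1, ha' _ (act_mem_V _ hp.1), mul_mul_mul_comm, hε, one_mul, hsb] at h
  have h1 := a'.val_act_mul_nonneg 1 hx hp
  have h2 := a'.val_act_mul_nonneg b.reflection hx hp
  rw [act_one, act_one] at h1
  rw [hx0] at h2
  -- The point `x` lies in the closures of both `A` and `sA`, on which `a'` has opposite signs.
  have h3 : a'.val x = 0 := by
    by_contra hne
    have h4 : 0 < a'.val x * a'.val x := mul_self_pos.2 hne
    have h5 := mul_nonneg h1 h2
    rw [mul_mul_mul_comm] at h5
    exact absurd h5 (not_le.2 (mul_neg_of_pos_of_neg h4 h))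
  have h6 := hwall a' ((a'.mem_hyperplane_iff hxb.1).2 h3)
  rw [hrefl, hsb, a'.reflection_eq_of_hyperplane_eq b h6]

/-- A word is a gallery of adjacent alcoves. If its ends are separated by the hyperplane of `a`,
some step crosses it, and there the reflection in `a` is the conjugate of the letter `s`. -/
theorem exists_conj_of_separates {n : ℕ} (a : AffineRoot n) (l : List (affineWeyl n))
    (hl : ∀ s ∈ l, s ∈ simpleReflections n) (w : IwahoriWeyl n)
    (h : a.val (act w (basePoint n)) * a.val (act (w * (l.prod : affineWeyl n)) (basePoint n)) < 0) :
    ∃ (l₁ : List (affineWeyl n)) (s : affineWeyl n) (l₂ : List (affineWeyl n)), l = l₁ ++ s :: l₂ ∧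
      a.reflection * (w * (l₁.prod : affineWeyl n)) = w * (l₁.prod : affineWeyl n) * s := by
  induction l generalizing w with
  | nil =>
    simp only [List.prod_nil, OneMemClass.coe_one, mul_one] at h
    exact absurd h (not_lt.2 (mul_self_nonneg _))
  | cons s t ih =>
    by_cases h1 : a.val (act w (basePoint n)) * a.val (act (w * s) (basePoint n)) < 0
    · refine ⟨[], s, t, rfl, ?_⟩
      simpa using reflection_eq_conj a w (hl s List.mem_cons_self) h1
    · have hp := basePoint_mem_alcove n
      have e1 := a.val_act_mul_pos w hp hp
      have e2 := a.val_act_mul_pos (w * s) hp hp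
      obtain ⟨l₁, s', l₂, hl', h2⟩ := ih (fun s' hs' => hl s' (List.mem_cons_of_mem _ hs')) (w * s) (by
        rw [List.prod_cons, Subgroup.coe_mul, ← mul_assoc] at h
        have e3 := lt_of_le_of_ne (not_lt.1 h1) (fun h0 => by
          rcases mul_eq_zero.1 h0.symm with h0 | h0
          · rw [h0, zero_mul] at e1; exact lt_irrefl _ e1
          · rw [h0, zero_mul] at e2; exact lt_irrefl _ e2)
        by_contra h4
        have h5 := mul_nonneg e3.le (not_lt.1 h4)
        rw [mul_mul_mul_comm, mul_comm (a.val (act (w * s) (basePoint n))),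
          mul_mul_mul_comm] at h5
        have h6 := mul_neg_of_neg_of_pos h e2
        linarith)
      refine ⟨s :: l₁, s', l₂, by rw [hl']; rfl, ?_⟩
      rw [List.prod_cons, Subgroup.coe_mul, ← mul_assoc w]
      exact h2

/-! ### Walls of the base alcove -/

/-- Simple roots and the highest root bound all positive roots. For `n = 2` the root system is `A₁ ×
A₁`, with a second highest root; hence `h4`. -/
theorem mem_alcove_of_simple {n : ℕ} (hn : 2 ≤ n) {x : Fin (2 * n) → ℝ} (hx : x ∈ V n)
    (h1 : ∀ (i : ℕ) (hi : i + 1 < n), x ⟨i + 1, by omega⟩ < x ⟨i, by omega⟩)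
    (h2 : x ⟨n, by omega⟩ < x ⟨n - 2, by omega⟩)
    (h3 : x ⟨0, by omega⟩ - x ⟨2 * n - 2, by omega⟩ < 1)
    (h4 : n = 2 → x ⟨0, by omega⟩ - x ⟨1, by omega⟩ < 1) : x ∈ alcove n := by
  obtain ⟨f, hf⟩ : ∃ f : ℕ → ℝ, ∀ (k : ℕ) (hk : k < 2 * n), x ⟨k, hk⟩ = f k :=
    ⟨fun k => if h : k < 2 * n then x ⟨k, h⟩ else 0, fun k hk => by simp [hk]⟩
  have hrev : ∀ k, k < 2 * n → f (2 * n - 1 - k) = - f k := by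
    intro k hk
    have := hx ⟨k, hk⟩
    rw [← hf k hk, ← hf _ (by omega), ← this]
    congr 1
    apply Fin.ext
    rw [Fin.val_rev]
    simp only
    omega
  simp only [hf] at h1 h2 h3 h4
  have hA' : ∀ d i, i + d + 1 < n → f (i + d + 1) < f i := by
    intro d
    induction d with
    | zero => exact fun i hi => h1 i hi
    | succ d ih => exact fun i hi => (h1 (i + d + 1) hi).trans (ih i (by omega))
  have hA : ∀ i j, i < j → j < n → f j < f i := by
    intro i j hij hj
    have := hA' (j - i - 1) i (by omega)
    rwa [show i + (j - i - 1) + 1 = j by omega] at this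
  have hB : ∀ i j, n ≤ i → i < j → j < 2 * n → f j < f i := by
    intro i j hi hij hj
    have := hA (2 * n - 1 - j) (2 * n - 1 - i) (by omega) (by omega)
    rw [hrev _ hj, hrev _ (by omega)] at this
    linarith
  have h2' : f (n + 1) < f (n - 1) := by
    have e1 := hrev (n - 2) (by omega)
    have e2 := hrev n (by omega)
    rw [show 2 * n - 1 - (n - 2) = n + 1 by omega] at e1
    rw [show 2 * n - 1 - n = n - 1 by omega] at e2
    linarith
  have hpos : ∀ i j, i < j → j < 2 * n → i + j ≠ 2 * n - 1 → f j < f i := by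
    intro i j hij hj hne
    rcases lt_or_ge j n with c1 | c1
    · exact hA i j hij c1
    rcases lt_or_ge i n with c2 | c2
    · rcases Nat.lt_or_ge i (n - 1) with c3 | c3
      · have e1 : f j ≤ f n := by
          rcases c1.eq_or_lt with e | e
          · rw [e]
          · exact (hB n j le_rfl e hj).le
        have e2 : f (n - 2) ≤ f i := by
          rcases (show i ≤ n - 2 by omega).eq_or_lt with e | e
          · rw [e]
          · exact (hA i (n - 2) e (by omega)).le
        linarith
      · have e0 : i = n - 1 := by omega
        have e1 : f j ≤ f (n + 1) := by
          rcases (show n + 1 ≤ j by omega).eq_or_lt with e | e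
          · rw [e]
          · exact (hB (n + 1) j (by omega) e hj).le
        rw [e0]
        linarith
    · exact hB i j c2 hij hj
  have hzero : ∀ j, 0 < j → j < 2 * n - 1 → f 0 - f j < 1 := by
    intro j hj0 hj
    by_cases j1 : j = 1
    · rw [j1]
      by_cases n2 : n = 2
      · exact h4 n2
      · have := hpos 1 2 (by omega) (by omega) (by omega)
        have e : f (2 * n - 2) ≤ f 2 := by
          rcases (show 2 ≤ 2 * n - 2 by omega).eq_or_lt with e | e
          · rw [← e]
          · exact (hpos 2 (2 * n - 2) e (by omega) (by omega)).le
        linarith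
    · have e : f (2 * n - 2) ≤ f j := by
        rcases (show j ≤ 2 * n - 2 by omega).eq_or_lt with e | e
        · rw [e]
        · exact (hpos j (2 * n - 2) e (by omega) (by omega)).le
      linarith
  refine ⟨hx, fun i j hij hne => ?_⟩
  obtain ⟨i, hi⟩ := i
  obtain ⟨j, hj⟩ := j
  rw [hf, hf]
  rw [Fin.lt_def] at hij
  rw [ne_eq, Fin.ext_iff, Fin.val_rev] at hne
  simp only at hij hne
  refine ⟨sub_pos.2 (hpos i j hij hj (by omega)), ?_⟩
  rcases Nat.eq_zero_or_pos i with i0 | i0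
  · rw [i0]
    exact hzero j (by omega) (by omega)
  rcases Nat.lt_or_ge j (2 * n - 1) with j1 | j1
  · have := hpos 0 i i0 hi (by omega)
    have := hzero j (by omega) j1
    linarith
  · have e1 := hzero (2 * n - 1 - i) (by omega) (by omega)
    have e2 := hrev 0 (by omega)
    rw [hrev i hi] at e1
    rw [show j = 2 * n - 1 - 0 by omega, e2]
    linarith

/-- The point `X / (4n)` gives every positive root a value strictly between 0 and 1, except for `(i,
j)` and `(j*, i*)`, which index the same root. -/
theorem AffineRoot.isWall_of_int {n : ℕ} (a : AffineRoot n) (hd : a.d = 0 ∨ a.d = 1) (X : ℕ → ℤ)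
    (hrev : ∀ k, k < 2 * n → X (2 * n - 1 - k) = - X k)
    (hval : X a.i - X a.j = 4 * n * a.d)
    (hX : ∀ k l, k < l → l < 2 * n → k + l ≠ 2 * n - 1 → (0 < X k - X l ∧ X k - X l < 4 * n) ∨
      (k = a.i ∧ l = a.j) ∨ (k = 2 * n - 1 - a.j ∧ l = 2 * n - 1 - a.i)) : a.IsWall := by
  have hn : 0 < n := by have := a.i.2; omega
  have hn' : (0 : ℝ) < 4 * n := by
    have : (0 : ℝ) < n := by exact_mod_cast hn
    linarith
  set x : Fin (2 * n) → ℝ := fun k => (X k : ℝ) / (4 * n) with hx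
  have hxV : x ∈ V n := by
    intro k
    have := hrev k k.2
    rw [show 2 * n - 1 - (k : ℕ) = k.rev by rw [Fin.val_rev]; omega] at this
    simp only [hx, this]
    push_cast
    ring
  have hxa : x a.i - x a.j = a.d := by
    have : (X a.i - X a.j : ℝ) = 4 * n * a.d := by exact_mod_cast hval
    simp only [hx]
    rw [← sub_div, this]
    field_simp
  have hxa' : x a.j.rev - x a.i.rev = a.d := by
    rw [hxV, hxV, ← hxa]
    ring
  have key : ∀ k l : Fin (2 * n), k < l → l ≠ k.rev → (0 < x k - x l ∧ x k - x l < 1) ∨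
      (k = a.i ∧ l = a.j) ∨ (k = a.j.rev ∧ l = a.i.rev) := by
    intro k l hkl hne
    rw [ne_eq, Fin.ext_iff, Fin.val_rev] at hne
    rcases hX k l hkl l.2 (by have := k.2; omega) with ⟨e1, e2⟩ | ⟨e1, e2⟩ | ⟨e1, e2⟩
    · left
      have e3 : (0 : ℝ) < X k - X l := by exact_mod_cast e1
      have e4 : (X k - X l : ℝ) < 4 * n := by exact_mod_cast e2
      simp only [hx]
      rw [← sub_div]
      exact ⟨div_pos e3 hn', (div_lt_one hn').2 e4⟩
    · exact Or.inr (Or.inl ⟨Fin.ext e1, Fin.ext e2⟩)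
    · refine Or.inr (Or.inr ⟨Fin.ext ?_, Fin.ext ?_⟩)
      · rw [Fin.val_rev]; omega
      · rw [Fin.val_rev]; omega
  have hd' : (0 : ℝ) ≤ a.d ∧ (a.d : ℝ) ≤ 1 := by rcases hd with h | h <;> rw [h] <;> norm_num
  refine ⟨x, closedAlcove_subset_closure n ⟨hxV, fun k l hkl hne => ?_⟩, ⟨hxV, hxa⟩,
    fun b hb => ?_⟩
  · rcases key k l hkl hne with h | ⟨rfl, rfl⟩ | ⟨rfl, rfl⟩
    · exact ⟨h.1.le, h.2.le⟩
    · rwa [hxa]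
    · rwa [hxa']
  · have hb' := hb.2
    rcases key b.i b.j b.lt b.ne with ⟨e1, e2⟩ | ⟨e1, e2⟩ | ⟨e1, e2⟩
    · rw [hb'] at e1 e2
      have e1 : 0 < b.d := by exact_mod_cast e1
      have e2 : b.d < 1 := by exact_mod_cast e2
      omega
    · rw [e1, e2, hxa] at hb'
      ext y
      simp only [hyperplane, Set.mem_ofPred_eq, e1, e2, hb']
    · rw [e1, e2, hxa'] at hb'
      ext y
      simp only [hyperplane, Set.mem_ofPred_eq, e1, e2, ← hb']
      refine and_congr_right fun hy => ?_
      rw [hy, hy, show - y a.j - - y a.i = y a.i - y a.j by ring]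

/-- A point off the base alcove is separated from it by a wall. -/
theorem exists_isWall {n : ℕ} (hn : 2 ≤ n) {x : Fin (2 * n) → ℝ} (hx : x ∈ V n)
    (hxA : x ∉ alcove n) : ∃ a : AffineRoot n, a.IsWall ∧ a.val x * a.val (basePoint n) ≤ 0 := by
  by_contra! hcon
  apply hxA
  have hp := basePoint_mem_alcove n
  have h0 : ∀ a : AffineRoot n, a.IsWall → a.d = 0 → x a.j < x a.i := by
    intro a ha hd
    have h1 := hcon a ha
    rcases a.val_pos_or_neg _ hp with ⟨h2, -⟩ | ⟨-, h2⟩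
    · have := pos_of_mul_pos_left h1 h2.le
      rw [AffineRoot.val, hd, Int.cast_zero] at this
      linarith
    · omega
  have h1 : ∀ a : AffineRoot n, a.IsWall → a.d = 1 → x a.i - x a.j < 1 := by
    intro a ha hd
    have h1 := hcon a ha
    rcases a.val_pos_or_neg _ hp with ⟨-, h2⟩ | ⟨h2, -⟩
    · omega
    · have := neg_of_mul_pos_left h1 h2.le
      rw [AffineRoot.val, hd, Int.cast_one] at this
      linarith
  refine mem_alcove_of_simple hn hx (fun i hi => ?_) ?_ ?_ (fun n2 => ?_)
  -- In all four cases the witness is `4n` times the orthogonal projection of the base point, with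
  -- numerators `2n - 1 - 2k`, to the wall.
  · refine h0 ⟨⟨i, by omega⟩, ⟨i + 1, by omega⟩, by simp [Fin.lt_def], by
      rw [ne_eq, Fin.ext_iff, Fin.val_rev]; simp only; omega, 0⟩
      (AffineRoot.isWall_of_int _ (Or.inl rfl) (fun k => if k = i ∨ k = i + 1 then 2 * n - 2 - 2 * i
        else if k + i + 1 = 2 * n ∨ k + i + 2 = 2 * n then -(2 * n - 2 - 2 * i)
        else 2 * n - 1 - 2 * k) (fun k hk => ?_) ?_ fun k l hkl hl hne => ?_) rfl
    · split_ifs <;> omega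
    · simp
    · dsimp only
      split_ifs <;> omega
  · refine h0 ⟨⟨n - 2, by omega⟩, ⟨n, by omega⟩, by simp only [Fin.lt_def]; omega, by
      rw [ne_eq, Fin.ext_iff, Fin.val_rev]; simp only; omega, 0⟩
      (AffineRoot.isWall_of_int _ (Or.inl rfl) (fun k => if k + 2 = n ∨ k = n then 1
        else if k + 1 = n ∨ k = n + 1 then -1 else 2 * n - 1 - 2 * k) (fun k hk => ?_) ?_
        fun k l hkl hl hne => ?_) rfl
    · split_ifs <;> omega
    · dsimp only
      split_ifs <;> omega
    · dsimp only
      split_ifs <;> omega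
  · refine h1 ⟨⟨0, by omega⟩, ⟨2 * n - 2, by omega⟩, by simp only [Fin.lt_def]; omega, by
      rw [ne_eq, Fin.ext_iff, Fin.val_rev]; simp only; omega, 1⟩
      (AffineRoot.isWall_of_int _ (Or.inr rfl) (fun k => if k ≤ 1 then 2 * n + 1 - 2 * k
        else if 2 * n ≤ k + 2 then 2 * n - 3 - 2 * k else 2 * n - 1 - 2 * k) (fun k hk => ?_) ?_
        fun k l hkl hl hne => ?_) rfl
    · split_ifs <;> omega
    · dsimp only
      split_ifs <;> omega
    · dsimp only
      split_ifs <;> omega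
  · refine h1 ⟨⟨0, by omega⟩, ⟨1, by omega⟩, by simp only [Fin.lt_def]; omega, by
      rw [ne_eq, Fin.ext_iff, Fin.val_rev]; simp only; omega, 1⟩
      (AffineRoot.isWall_of_int _ (Or.inr rfl) (fun k => if k = 0 then 6 else if k = 1 then -2
        else if k = 2 then 2 else -6) (fun k hk => ?_) ?_ fun k l hkl hl hne => ?_) rfl
    · split_ifs <;> omega
    · norm_num [n2]
    · dsimp only
      split_ifs <;> omega

/-! ### Generation of `W_a` by wall reflections, and the stabilizer of the alcove -/

theorem AffineRoot.reflection_mul_self {n : ℕ} (a : AffineRoot n) :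
    a.reflection * a.reflection = 1 := by
  refine eq_of_act_eq fun x hx => ?_
  rw [act_mul, act_one, a.act_reflection_eq (act_mem_V _ hx), a.act_reflection_eq hx]
  funext k
  simp only [val, Pi.sub_apply, Pi.smul_apply, smul_eq_mul, realCoroot_i, realCoroot_j]
  ring

theorem act_mem_alcove {n : ℕ} {w : IwahoriWeyl n} {x y : Fin (2 * n) → ℝ} (hx : x ∈ alcove n)
    (hwx : act w x ∈ alcove n) (hy : y ∈ alcove n) : act w y ∈ alcove n := by
  refine ⟨act_mem_V w hy.1, fun i j hij hne => ?_⟩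
  obtain ⟨h1, h2⟩ := hwx.2 i j hij hne
  have e1 := AffineRoot.val_act_mul_pos ⟨i, j, hij, hne, 0⟩ w hx hy
  have e2 := AffineRoot.val_act_mul_pos ⟨i, j, hij, hne, 1⟩ w hx hy
  simp only [AffineRoot.val, Int.cast_zero, Int.cast_one, sub_zero] at e1 e2
  refine ⟨pos_of_mul_pos_right e1 h1.le, ?_⟩
  have := neg_of_mul_pos_right e2 (by linarith)
  linarith

theorem mem_alcoveStabilizer {n : ℕ} {w : IwahoriWeyl n} {x : Fin (2 * n) → ℝ} (hx : x ∈ alcove n)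
    (hwx : act w x ∈ alcove n) : w ∈ alcoveStabilizer n := by
  refine Set.Subset.antisymm ?_ fun y hy => ?_
  · rintro _ ⟨y, hy, rfl⟩
    exact act_mem_alcove hx hwx hy
  · refine ⟨act w⁻¹ y, act_mem_alcove hwx ?_ hy, ?_⟩
    · rwa [← act_mul, inv_mul_cancel, act_one]
    · rw [← act_mul, mul_inv_cancel, act_one]

/-- Reflecting `x` in a hyperplane that separates it from `p` brings it closer to `p`. -/
theorem AffineRoot.sum_sq_act_reflection {n : ℕ} (a : AffineRoot n) {x p : Fin (2 * n) → ℝ}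
    (hx : x ∈ V n) (hp : p ∈ V n) :
    ∑ i, (act a.reflection x i - p i) ^ 2 = ∑ i, (x i - p i) ^ 2 + 4 * (a.val x * a.val p) := by
  have hxp : x - p ∈ V n := fun i => by
    simp only [Pi.sub_apply, hx i, hp i]
    ring
  have e1 := a.sum_realCoroot_mul hxp
  have e2 := a.sum_realCoroot_mul a.realCoroot_mem
  rw [a.realCoroot_i, a.realCoroot_j] at e2
  have e3 : ∀ i, (act a.reflection x i - p i) ^ 2 = (x i - p i) ^ 2 -
      2 * a.val x * (a.realCoroot i * (x - p) i) +
      a.val x ^ 2 * (a.realCoroot i * a.realCoroot i) := by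
    intro i
    rw [a.act_reflection_eq hx]
    simp only [Pi.sub_apply, Pi.smul_apply, smul_eq_mul]
    ring
  simp only [e3, Finset.sum_add_distrib, Finset.sum_sub_distrib, ← Finset.mul_sum, e1, e2]
  simp only [val, Pi.sub_apply]
  ring

theorem exists_nat_eq_sum_sq {n : ℕ} (w : IwahoriWeyl n) :
    ∃ M : ℕ, (M : ℝ) =
      (4 * n) ^ 2 * ∑ i, (act w (basePoint n) i - basePoint n i) ^ 2 := by
  have h : ∀ i, (4 * n) ^ 2 * (act w (basePoint n) i - basePoint n i) ^ 2 =
      (((4 * n * (w.left.toAdd : Fin (2 * n) → ℤ) i - 2 * ((w.right : Equiv.Perm (Fin (2 * n)))⁻¹ i : ℕ)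
        + 2 * (i : ℕ)) ^ 2 : ℤ) : ℝ) := by
    intro i
    have : 0 < n := by have := i.2; omega
    have : (0 : ℝ) < n := by exact_mod_cast this
    rw [← mul_pow]
    push_cast
    congr 1
    simp only [act, basePoint]
    field_simp
    ring
  refine ⟨(∑ i, (4 * n * (w.left.toAdd : Fin (2 * n) → ℤ) i -
    2 * ((w.right : Equiv.Perm (Fin (2 * n)))⁻¹ i : ℕ) + 2 * (i : ℕ)) ^ 2 : ℤ).toNat, ?_⟩
  rw [Finset.mul_sum, Finset.sum_congr rfl fun i _ => h i, ← Int.cast_sum, ← Int.cast_natCast,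
    Int.toNat_of_nonneg (Finset.sum_nonneg fun i _ => sq_nonneg _)]

/-- Descent on the squared distance from `w p` to `p`, which is a natural number after scaling by
`(4n)²`: while `w p` is outside the alcove, some wall separates the two points. -/
theorem exists_closure_mul_stabilizer {n : ℕ} (hn : 2 ≤ n) (w : IwahoriWeyl n) :
    ∃ g ∈ Submonoid.closure (simpleReflections n), ∃ ω ∈ alcoveStabilizer n,
      w = (g : IwahoriWeyl n) * ω := by
  obtain ⟨M, hM⟩ := exists_nat_eq_sum_sq w
  induction M using Nat.strong_induction_on generalizing w with
  | _ M ih =>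
    have hp := basePoint_mem_alcove n
    by_cases hw : act w (basePoint n) ∈ alcove n
    · exact ⟨1, one_mem _, w, mem_alcoveStabilizer hp hw, by simp⟩
    obtain ⟨a, ha, hle⟩ := exists_isWall hn (act_mem_V w hp.1) hw
    have hlt : a.val (act w (basePoint n)) * a.val (basePoint n) < 0 := by
      refine lt_of_le_of_ne hle fun h0 => ?_
      have e1 := a.val_act_mul_pos w hp hp
      have e2 := a.val_mul_val_pos hp hp
      have := mul_pos e1 e2
      rw [mul_mul_mul_comm, h0, zero_mul] at this
      exact lt_irrefl _ this
    obtain ⟨M', hM'⟩ := exists_nat_eq_sum_sq (a.reflection * w)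
    have hM'M : M' < M := by
      have hn' : (0 : ℝ) < (4 * n) ^ 2 := by
        have : (0 : ℝ) < n := by exact_mod_cast (by omega : 0 < n)
        positivity
      have : (M' : ℝ) < M := by
        rw [hM, hM', act_mul, a.sum_sq_act_reflection (act_mem_V w hp.1) hp.1]
        exact mul_lt_mul_of_pos_left (by linarith) hn'
      exact_mod_cast this
    obtain ⟨g, hg, ω, hω, h⟩ := ih M' hM'M (a.reflection * w) hM'
    refine ⟨⟨a.reflection, a.reflection_mem⟩ * g,
      mul_mem (Submonoid.subset_closure ⟨a, ha, rfl⟩) hg, ω, hω, ?_⟩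
    rw [Subgroup.coe_mul, mul_assoc, ← h, ← mul_assoc, a.reflection_mul_self, one_mul]

theorem eq_one_of_strictMono {m : ℕ} {τ : Equiv.Perm (Fin m)} (h : StrictMono τ) : τ = 1 := by
  have : (OrderIso.ofRelIsoLT ⟨τ, fun {a b} => h.lt_iff_lt⟩ : Fin m ≃o Fin m) = OrderIso.refl _ :=
    Subsingleton.elim _ _
  ext1 i
  exact DFunLike.congr_fun this i

/-- A permutation that preserves the order of the positive roots and is even is trivial. -/
theorem eq_one_of_lt {n : ℕ} (hn : 2 ≤ n) {τ : Equiv.Perm (Fin (2 * n))}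
    (hsign : Equiv.Perm.sign τ = 1)
    (h : ∀ i j, i < j → j ≠ i.rev → τ i < τ j) : τ = 1 := by
  have hout : ∀ i : Fin (2 * n), (i : ℕ) + 1 < n → τ i < τ i.rev := by
    intro i hi
    have h1 := h i ⟨i + 1, by omega⟩ (by simp [Fin.lt_def]) (by
      rw [ne_eq, Fin.ext_iff, Fin.val_rev]; simp only; omega)
    have h2 := h ⟨i + 1, by omega⟩ i.rev (by rw [Fin.lt_def, Fin.val_rev]; simp only; omega) (by
      rw [ne_eq, Fin.rev_inj, Fin.ext_iff]; simp only; omega)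
    exact h1.trans h2
  set u : Fin (2 * n) := ⟨n - 1, by omega⟩ with hu
  set v : Fin (2 * n) := ⟨n, by omega⟩ with hv
  have huv : u ≠ v := by rw [ne_eq, Fin.ext_iff]; simp only [hu, hv]; omega
  -- Only the order of the images of `n - 1` and `n` is undetermined. If it is reversed, `τ` is the
  -- transposition of these two, which is odd.
  rcases lt_or_gt_of_ne (τ.injective.ne huv) with huv' | huv'
  · refine eq_one_of_strictMono fun i j hij => ?_
    by_cases hji : j = i.rev
    · by_cases hi : (i : ℕ) + 1 < n
      · rw [hji]; exact hout i hi
      · rw [hji, Fin.lt_def, Fin.val_rev] at hij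
        have e1 : i = u := Fin.ext (by simp only [hu]; omega)
        have e2 : j = v := by rw [hji]; exact Fin.ext (by rw [Fin.val_rev]; simp only [hv]; omega)
        rw [e1, e2]; exact huv'
    · exact h i j hij hji
  · exfalso
    have hne : ∀ i : Fin (2 * n), i ≠ u → i ≠ v → Equiv.swap u v i = i := fun i =>
      Equiv.swap_apply_of_ne_of_ne
    have hval : ∀ i : Fin (2 * n), i ≠ u → i ≠ v → (i : ℕ) + 1 < n ∨ n < (i : ℕ) := by
      intro i h1 h2
      rw [ne_eq, Fin.ext_iff] at h1 h2
      simp only [hu, hv] at h1 h2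
      omega
    have h1 : τ * Equiv.swap u v = 1 := by
      refine eq_one_of_strictMono fun i j hij => ?_
      rw [Equiv.Perm.mul_apply, Equiv.Perm.mul_apply]
      rw [Fin.lt_def] at hij
      have huval : (u : ℕ) = n - 1 := rfl
      have hvval : (v : ℕ) = n := rfl
      have hmid : ∀ k : Fin (2 * n), k = u ∨ k = v →
          Equiv.swap u v k = u ∨ Equiv.swap u v k = v := by
        rintro k (rfl | rfl)
        · right; exact Equiv.swap_apply_left _ _
        · left; exact Equiv.swap_apply_right _ _
      by_cases hi : i = u ∨ i = v
      · by_cases hj : j = u ∨ j = v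
        · have e1 : i = u := by
            rcases hi with hi | hi
            · exact hi
            · rcases hj with hj | hj <;> rw [hi, hj] at hij <;> omega
          have e2 : j = v := by
            rcases hj with hj | hj
            · rw [e1, hj] at hij; omega
            · exact hj
          rw [e1, e2, Equiv.swap_apply_left, Equiv.swap_apply_right]
          exact huv'
        · rw [not_or] at hj
          rw [hne j hj.1 hj.2]
          have h3 := hval j hj.1 hj.2
          have h4 : (i : ℕ) = n - 1 ∨ (i : ℕ) = n := by rcases hi with hi | hi <;> rw [hi] <;> omega
          rcases hmid i hi with e | e <;> rw [e] <;> refine h _ _ ?_ ?_ <;>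
            simp only [ne_eq, Fin.lt_def, Fin.ext_iff, Fin.val_rev, huval, hvval] <;> omega
      · rw [not_or] at hi
        rw [hne i hi.1 hi.2]
        have h3 := hval i hi.1 hi.2
        by_cases hj : j = u ∨ j = v
        · have h4 : (j : ℕ) = n - 1 ∨ (j : ℕ) = n := by rcases hj with hj | hj <;> rw [hj] <;> omega
          rcases hmid j hj with e | e <;> rw [e] <;> refine h _ _ ?_ ?_ <;>
            simp only [ne_eq, Fin.lt_def, Fin.ext_iff, Fin.val_rev, huval, hvval] <;> omega
        · rw [not_or] at hj
          rw [hne j hj.1 hj.2]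
          by_cases hji : j = i.rev
          · rw [hji]
            refine hout i ?_
            rw [hji, Fin.val_rev] at hij
            omega
          · exact h i j hij hji
    have h2 := congrArg Equiv.Perm.sign h1
    rw [map_mul, hsign, Equiv.Perm.sign_swap huv, map_one] at h2
    exact absurd h2 (by decide)

/-- In the alcove the entries `1, …, n - 1` have absolute value below `1/2` and entry `0` lies in
`(0, 1)`. So `ν` vanishes except possibly for a first entry equal to 1, which the even sum excludes.
-/
theorem left_eq_zero_of_mem {n : ℕ} (hn : 2 ≤ n) {ν : Cochar n} (hν : ν ∈ corootLattice n)
    {y : Fin (2 * n) → ℝ} (hy : ∀ i, |y i| < 1 / 2)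
    (h : (fun i => ((ν : Fin (2 * n) → ℤ) i : ℝ) + y i) ∈ alcove n) : ν = 0 := by
  have hz : ∀ i : Fin (2 * n), (i : ℕ) ≠ 0 → (i : ℕ) < n → (ν : Fin (2 * n) → ℤ) i = 0 := by
    intro i hi0 hin
    have h1 := h.2 ⟨0, by omega⟩ i (by rw [Fin.lt_def]; simp only; omega) (by
      rw [ne_eq, Fin.ext_iff, Fin.val_rev]; simp only; omega)
    have h2 := h.2 ⟨0, by omega⟩ i.rev (by rw [Fin.lt_def, Fin.val_rev]; simp only; omega) (by
      rw [ne_eq, Fin.rev_inj, Fin.ext_iff]; simp only; omega)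
    have h3 := h.1 i
    simp only at h1 h2 h3
    have h4 := abs_lt.1 (hy i)
    rw [h3] at h2
    have h5 : ((ν : Fin (2 * n) → ℤ) i : ℝ) < 1 := by linarith
    have h6 : (-1 : ℝ) < ((ν : Fin (2 * n) → ℤ) i : ℝ) := by linarith
    have h5' : (ν : Fin (2 * n) → ℤ) i < 1 := by exact_mod_cast h5
    have h6' : -1 < (ν : Fin (2 * n) → ℤ) i := by exact_mod_cast h6
    omega
  have h0 : (ν : Fin (2 * n) → ℤ) ⟨0, by omega⟩ = 0 := by
    have hsum : ∑ i : Fin n, (ν : Fin (2 * n) → ℤ) (Fin.castLE (Nat.le_mul_of_pos_left n two_pos) i)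
        = (ν : Fin (2 * n) → ℤ) ⟨0, by omega⟩ := by
      rw [Finset.sum_eq_single (⟨0, by omega⟩ : Fin n)]
      · rfl
      · intro b _ hb
        refine hz _ ?_ b.2
        simpa [Fin.ext_iff] using hb
      · simp
    have heven : Even (∑ i : Fin n,
      (ν : Fin (2 * n) → ℤ) (Fin.castLE (Nat.le_mul_of_pos_left n two_pos) i)) := hν
    rw [hsum] at heven
    have h1 := h.2 ⟨0, by omega⟩ ⟨1, by omega⟩ (by simp [Fin.lt_def]) (by
      rw [ne_eq, Fin.ext_iff, Fin.val_rev]; simp only; omega)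
    have h2 := h.2 ⟨0, by omega⟩ (Fin.rev ⟨1, by omega⟩) (by
      rw [Fin.lt_def, Fin.val_rev]; simp only; omega) (by
      rw [ne_eq, Fin.rev_inj, Fin.ext_iff]; simp)
    have h3 := h.1 ⟨1, by omega⟩
    simp only at h1 h2 h3
    rw [h3] at h2
    have h4 := abs_lt.1 (hy ⟨0, by omega⟩)
    have h5 : ((ν : Fin (2 * n) → ℤ) ⟨0, by omega⟩ : ℝ) < 2 := by linarith
    have h6 : (-1 : ℝ) < ((ν : Fin (2 * n) → ℤ) ⟨0, by omega⟩ : ℝ) := by linarith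
    have h5' : (ν : Fin (2 * n) → ℤ) ⟨0, by omega⟩ < 2 := by exact_mod_cast h5
    have h6' : -1 < (ν : Fin (2 * n) → ℤ) ⟨0, by omega⟩ := by exact_mod_cast h6
    obtain ⟨r, hr⟩ := heven
    omega
  have hlow : ∀ i : Fin (2 * n), (i : ℕ) < n → (ν : Fin (2 * n) → ℤ) i = 0 := by
    intro i hi
    by_cases hi0 : (i : ℕ) = 0
    · rw [show i = ⟨0, by omega⟩ from Fin.ext hi0, h0]
    · exact hz i hi0 hi
  refine Subtype.ext (funext fun i => ?_)
  by_cases hi : (i : ℕ) < n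
  · exact hlow i hi
  · have := hlow i.rev (by rw [Fin.val_rev]; omega)
    rw [ν.2 i, neg_eq_zero] at this
    exact this

theorem abs_basePoint_lt {n : ℕ} (k : Fin (2 * n)) : |basePoint n k| < 1 / 2 := by
  have hn : 0 < n := by have := k.2; omega
  have hn' : (0 : ℝ) < n := by exact_mod_cast hn
  have h1 : (((k : ℕ) + 1 : ℕ) : ℝ) ≤ ((2 * n : ℕ) : ℝ) := Nat.cast_le.2 k.2
  have h2 : (0 : ℝ) ≤ (k : ℕ) := Nat.cast_nonneg _
  push_cast at h1
  rw [basePoint, abs_lt, lt_div_iff₀ (by positivity), div_lt_iff₀ (by positivity)]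
  constructor <;> linarith

theorem eq_one_of_mem_stabilizer {n : ℕ} (hn : 2 ≤ n) {w : IwahoriWeyl n} (hw : w ∈ affineWeyl n)
    (hw' : w ∈ alcoveStabilizer n) : w = 1 := by
  have hp : act w (basePoint n) ∈ alcove n := by
    have : act w '' alcove n = alcove n := hw'
    rw [← this]
    exact Set.mem_image_of_mem _ (basePoint_mem_alcove n)
  have hl : w.left.toAdd = 0 := by
    exact left_eq_zero_of_mem hn hw.1 (fun i => abs_basePoint_lt _) hp
  have hr : (w.right : Equiv.Perm (Fin (2 * n)))⁻¹ = 1 := by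
    refine eq_one_of_lt hn ?_ fun i j hij hne => ?_
    · rw [Equiv.Perm.sign_inv]
      exact hw.2
    · have := (hp.2 i j hij hne).1
      simp only [act, hl, ZeroMemClass.coe_zero, Pi.zero_apply, Int.cast_zero, zero_add] at this
      exact basePoint_lt_iff.1 (sub_pos.1 this)
  refine SemidirectProduct.ext hl (Subtype.ext ?_)
  rw [inv_eq_one] at hr
  exact hr

theorem mem_closure_simpleReflections {n : ℕ} (hn : 2 ≤ n) (g : affineWeyl n) :
    g ∈ Submonoid.closure (simpleReflections n) := by
  obtain ⟨x, hx, ω, hω, h⟩ := exists_closure_mul_stabilizer hn (g : IwahoriWeyl n)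
  have h1 : ω = ((x⁻¹ * g : affineWeyl n) : IwahoriWeyl n) := by
    rw [Subgroup.coe_mul, h, Subgroup.coe_inv, inv_mul_cancel_left]
  have h2 := eq_one_of_mem_stabilizer hn (h1 ▸ (x⁻¹ * g).2) hω
  rw [h2, mul_one] at h
  rwa [Subtype.ext h]

/-! ### Word length and sides of hyperplanes -/

theorem exists_word {n : ℕ} (hn : 2 ≤ n) (g : affineWeyl n) :
    ∃ l : List (affineWeyl n), (∀ s ∈ l, s ∈ simpleReflections n) ∧ l.prod = g :=
  Submonoid.exists_list_of_mem_closure (mem_closure_simpleReflections hn g)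

theorem exists_reduced_word {n : ℕ} (hn : 2 ≤ n) (g : affineWeyl n) :
    ∃ l : List (affineWeyl n), (∀ s ∈ l, s ∈ simpleReflections n) ∧ l.prod = g ∧
      l.length = wordLength (simpleReflections n) g := by
  obtain ⟨l, h1, h2⟩ := exists_word hn g
  exact Nat.sInf_mem (s := {k | ∃ l : List (affineWeyl n), (∀ s ∈ l, s ∈ simpleReflections n) ∧
    l.prod = g ∧ l.length = k}) ⟨_, l, h1, h2, rfl⟩

/-- Exchange property: multiplying by the reflection deletes one letter of a reduced word. -/
theorem wordLength_lt_of_separates {n : ℕ} (hn : 2 ≤ n) (a : AffineRoot n) (g : affineWeyl n)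
    (h : a.val (basePoint n) * a.val (act (g : IwahoriWeyl n) (basePoint n)) < 0) :
    wordLength (simpleReflections n) (⟨a.reflection, a.reflection_mem⟩ * g) <
      wordLength (simpleReflections n) g := by
  obtain ⟨l, hl, rfl, hlen⟩ := exists_reduced_word hn g
  obtain ⟨l₁, s, l₂, rfl, h1⟩ := exists_conj_of_separates a l hl 1 (by rwa [one_mul, act_one])
  rw [one_mul] at h1
  have hs : s * s = 1 := by
    obtain ⟨b, -, hb⟩ := hl s (by simp)
    apply Subtype.ext
    rw [Subgroup.coe_mul, hb, b.reflection_mul_self, OneMemClass.coe_one]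
  have h2 : (⟨a.reflection, a.reflection_mem⟩ : affineWeyl n) * (l₁ ++ s :: l₂).prod =
      (l₁ ++ l₂).prod := by
    have h3 : (⟨a.reflection, a.reflection_mem⟩ : affineWeyl n) * l₁.prod = l₁.prod * s :=
      Subtype.ext h1
    rw [List.prod_append, List.prod_cons, List.prod_append, ← mul_assoc, h3, mul_assoc,
      ← mul_assoc s, hs, one_mul]
  rw [← hlen, h2]
  refine lt_of_le_of_lt (Nat.sInf_le ⟨l₁ ++ l₂, fun t ht => hl t ?_, rfl, rfl⟩) ?_
  · simp only [List.mem_append, List.mem_cons] at ht ⊢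
    tauto
  · simp

theorem reflection_eq_conj_simple {n : ℕ} (hn : 2 ≤ n) (a : AffineRoot n) :
    ∃ s ∈ simpleReflections n, ∃ g : affineWeyl n,
      (⟨a.reflection, a.reflection_mem⟩ : affineWeyl n) = g * s * g⁻¹ := by
  have hp := basePoint_mem_alcove n
  obtain ⟨l, hl, hprod⟩ := exists_word hn ⟨a.reflection, a.reflection_mem⟩
  obtain ⟨l₁, s, l₂, rfl, h1⟩ := exists_conj_of_separates a l hl 1 (by
    rw [one_mul, act_one, hprod, a.act_reflection_eq hp.1]
    have h1 := a.val_mul_val_pos hp hp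
    have h2 : a.val (basePoint n - a.val (basePoint n) • a.realCoroot) = - a.val (basePoint n) := by
      simp only [AffineRoot.val, Pi.sub_apply, Pi.smul_apply, smul_eq_mul, a.realCoroot_i,
        a.realCoroot_j]
      ring
    rw [h2]
    linarith)
  rw [one_mul] at h1
  refine ⟨s, hl s (by simp), l₁.prod, ?_⟩
  rw [eq_mul_inv_iff_mul_eq]
  exact Subtype.ext h1

theorem wordLength_lt_of_same_side {n : ℕ} (hn : 2 ≤ n) (a : AffineRoot n) (g : affineWeyl n)
    (h : 0 < a.val (basePoint n) * a.val (act (g : IwahoriWeyl n) (basePoint n))) :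
    wordLength (simpleReflections n) g <
      wordLength (simpleReflections n) (⟨a.reflection, a.reflection_mem⟩ * g) := by
  have hp := basePoint_mem_alcove n
  have := wordLength_lt_of_separates hn a (⟨a.reflection, a.reflection_mem⟩ * g) (by
    rw [Subgroup.coe_mul, act_mul, a.act_reflection_eq (act_mem_V _ hp.1)]
    set x := act (g : IwahoriWeyl n) (basePoint n)
    have h2 : a.val (x - a.val x • a.realCoroot) = - a.val x := by
      simp only [AffineRoot.val, Pi.sub_apply, Pi.smul_apply, smul_eq_mul, a.realCoroot_i,
        a.realCoroot_j]
      ring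
    rw [h2]
    linarith)
  rwa [← mul_assoc, show (⟨a.reflection, a.reflection_mem⟩ : affineWeyl n) *
    ⟨a.reflection, a.reflection_mem⟩ = 1 from Subtype.ext a.reflection_mul_self, one_mul] at this

theorem coxeterBruhatLE_reflection_mul {n : ℕ} (hn : 2 ≤ n) (a : AffineRoot n) (g : affineWeyl n)
    (h : 0 < a.val (basePoint n) * a.val (act (g : IwahoriWeyl n) (basePoint n))) :
    CoxeterBruhatLE (simpleReflections n) g (⟨a.reflection, a.reflection_mem⟩ * g) := by
  obtain ⟨s, hs, t, e⟩ := reflection_eq_conj_simple hn a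
  refine Relation.ReflTransGen.single ⟨s, hs, t, by rw [e], wordLength_lt_of_same_side hn a g h⟩

/-! ### The orbit of `μ` and its convex hull -/

theorem AffineRoot.linearPart_mem {n : ℕ} (a : AffineRoot n) : a.linearPart ∈ EvenStarPerm n :=
  a.reflection_mem.2

/-- The group `S°_{2n}` acts transitively on the indices. -/
theorem exists_evenStarPerm {n : ℕ} (hn : 2 ≤ n) (c : Fin (2 * n)) :
    ∃ σ ∈ EvenStarPerm n, (σ : Equiv.Perm (Fin (2 * n))) ⟨0, by omega⟩ = c := by
  have key : ∀ (i j : Fin (2 * n)), i < j → j ≠ i.rev →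
      ∃ σ ∈ EvenStarPerm n, (σ : Equiv.Perm (Fin (2 * n))) i = j := fun i j h1 h2 =>
    ⟨_, AffineRoot.linearPart_mem ⟨i, j, h1, h2, 0⟩, doubleSwap_left h2⟩
  by_cases h0 : (c : ℕ) = 0
  · exact ⟨1, one_mem _, Fin.ext h0.symm⟩
  by_cases h1 : (c : ℕ) = 2 * n - 1
  · obtain ⟨σ, hσ, e⟩ := key ⟨0, by omega⟩ ⟨1, by omega⟩ (by simp [Fin.lt_def]) (by
      rw [ne_eq, Fin.ext_iff, Fin.val_rev]; simp only; omega)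
    obtain ⟨σ', hσ', e'⟩ := key ⟨1, by omega⟩ c (by simp only [Fin.lt_def]; omega) (by
      rw [ne_eq, Fin.ext_iff, Fin.val_rev]; simp only; omega)
    exact ⟨σ' * σ, mul_mem hσ' hσ, by
      rw [Subgroup.coe_mul, Equiv.Perm.mul_apply, e, e']⟩
  · exact key _ c (by simp only [Fin.lt_def]; omega) (by
      rw [ne_eq, Fin.ext_iff, Fin.val_rev]; simp only; omega)

theorem mu_apply {n : ℕ} (hn : 2 ≤ n) (i : Fin (2 * n)) :
    (((mu n : Cochar n) : Fin (2 * n) → ℤ) i : ℝ) = unitVec ⟨0, by omega⟩ i := by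
  simp only [mu, unitVec, Fin.ext_iff, Fin.val_rev]
  push_cast
  split_ifs <;> first | omega | norm_num

theorem permCochar_mu_apply {n : ℕ} (hn : 2 ≤ n) (σ : StarPerm n) (i : Fin (2 * n)) :
    (((permCochar σ (mu n) : Cochar n) : Fin (2 * n) → ℤ) i : ℝ) =
      unitVec ((σ : Equiv.Perm (Fin (2 * n))) ⟨0, by omega⟩) i := by
  have h : ∀ k l : Fin (2 * n), unitVec ((σ : Equiv.Perm (Fin (2 * n))) k)
      ((σ : Equiv.Perm (Fin (2 * n))) l) = unitVec k l := fun k l => by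
    simp only [unitVec, ← σ.2 k, (σ : Equiv.Perm (Fin (2 * n))).injective.eq_iff]
  change (((mu n : Cochar n) : Fin (2 * n) → ℤ) ((σ : Equiv.Perm (Fin (2 * n)))⁻¹ i) : ℝ) = _
  rw [mu_apply hn, ← h]
  simp

theorem mem_weylOrbit_mu {n : ℕ} (hn : 2 ≤ n) {ν : Cochar n} {c : Fin (2 * n)}
    (h : ∀ i, ((ν : Fin (2 * n) → ℤ) i : ℝ) = unitVec c i) : ν ∈ weylOrbit (mu n) := by
  obtain ⟨σ, hσ, hc⟩ := exists_evenStarPerm hn c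
  refine ⟨σ, hσ, Subtype.ext (funext fun i => ?_)⟩
  have := (h i).trans ((permCochar_mu_apply hn σ i).trans (by rw [hc])).symm
  exact_mod_cast this

theorem sum_abs_unitVec {n : ℕ} (c : Fin (2 * n)) : ∑ i, |unitVec c i| = 2 := by
  have e : ∑ i ∈ ({c, c.rev} : Finset (Fin (2 * n))), |unitVec c i| = ∑ i, |unitVec c i| := by
    refine Finset.sum_subset (Finset.subset_univ _) fun i _ hi => ?_
    simp only [Finset.mem_insert, Finset.mem_singleton, not_or] at hi
    rw [unitVec_of_ne hi.1 hi.2, abs_zero]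
  rw [← e, Finset.sum_pair (rev_ne_self c).symm, unitVec_rev, abs_neg, unitVec_self]
  norm_num

theorem sum_abs_le_of_mem_orbitHull {n : ℕ} (hn : 2 ≤ n) {x : Fin (2 * n) → ℝ}
    (hx : x ∈ orbitHull (mu n)) : ∑ i, |x i| ≤ 2 := by
  refine convexHull_min (t := {x : Fin (2 * n) → ℝ | ∑ i, |x i| ≤ 2}) ?_ ?_ hx
  · rintro _ ⟨_, ⟨σ, -, rfl⟩, rfl⟩
    simp only [Set.mem_ofPred_eq, permCochar_mu_apply hn, sum_abs_unitVec, le_refl]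
  · intro x hx y hy s t hs ht hst
    simp only [Set.mem_ofPred_eq, Pi.add_apply, Pi.smul_apply, smul_eq_mul] at hx hy ⊢
    calc ∑ i, |s * x i + t * y i| ≤ ∑ i, (s * |x i| + t * |y i|) :=
          Finset.sum_le_sum fun i _ => (abs_add_le _ _).trans_eq (by
            rw [abs_mul, abs_mul, abs_of_nonneg hs, abs_of_nonneg ht])
      _ = s * ∑ i, |x i| + t * ∑ i, |y i| := by
          rw [Finset.sum_add_distrib, Finset.mul_sum, Finset.mul_sum]
      _ ≤ s * 2 + t * 2 :=
          add_le_add (mul_le_mul_of_nonneg_left hx hs) (mul_le_mul_of_nonneg_left hy ht)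
      _ = 2 := by rw [← add_mul, hst, one_mul]

theorem mem_orbitHull_of_sum_abs_le {n : ℕ} (hn : 2 ≤ n) {x : Fin (2 * n) → ℝ} (hxV : x ∈ V n)
    (hx : ∑ i, |x i| ≤ 2) : x ∈ orbitHull (mu n) := by
  have hn' : (0 : ℝ) < 2 * n := by
    have : (0 : ℝ) < n := by exact_mod_cast (by omega : 0 < n)
    linarith
  have hsum0 : ∑ i, x i = 0 := by
    have h := Equiv.sum_comp Fin.revPerm x
    simp only [Fin.revPerm_apply, hxV _, Finset.sum_neg_distrib] at h
    linarith
  have hpos : ∑ i, max (x i) 0 ≤ 1 := by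
    have h : ∀ i, max (x i) 0 = (x i + |x i|) / 2 := fun i => by
      rcases le_total (x i) 0 with h | h
      · rw [max_eq_right h, abs_of_nonpos h]; ring
      · rw [max_eq_left h, abs_of_nonneg h]; ring
    simp only [h, ← Finset.sum_div, Finset.sum_add_distrib, hsum0]
    linarith
  -- The unused weight is spread evenly over all `c`; it contributes nothing, since the vectors for
  -- `c` and `c*` are opposite.
  set t := (1 - ∑ i, max (x i) 0) / (2 * n) with ht
  have ht0 : 0 ≤ t := div_nonneg (by linarith) hn'.le
  have hmem : ∀ c : Fin (2 * n), unitVec c ∈ orbitHull (mu n) := fun c => by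
    obtain ⟨σ, hσ, hc⟩ := exists_evenStarPerm hn c
    refine subset_convexHull ℝ _ ⟨permCochar σ (mu n), ⟨σ, hσ, rfl⟩, funext fun i => ?_⟩
    simp only [permCochar_mu_apply hn, hc]
  have hcomb : x = ∑ c, (max (x c) 0 + t) • unitVec c := by
    funext i
    rw [Finset.sum_apply]
    simp only [Pi.smul_apply, smul_eq_mul, unitVec, mul_sub, mul_ite, mul_one, mul_zero,
      Finset.sum_sub_distrib, Finset.sum_ite_eq, Finset.mem_univ, if_true, ← Fin.rev_eq_iff]
    rw [hxV i]
    rcases le_total (x i) 0 with h | h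
    · rw [max_eq_right h, max_eq_left (by linarith)]; ring
    · rw [max_eq_left h, max_eq_right (by linarith)]; ring
  rw [hcomb]
  refine (convex_convexHull ℝ _).sum_mem (fun c _ => add_nonneg (le_max_right _ _) ht0) ?_
    fun c _ => hmem c
  rw [Finset.sum_add_distrib, Finset.sum_const, Finset.card_univ, Fintype.card_fin, nsmul_eq_mul, ht]
  push_cast
  field_simp
  ring

theorem sum_abs_act_sub {n : ℕ} {w : IwahoriWeyl n} {c : Fin (2 * n)}
    (h : ∀ i, (((w.left.toAdd : Cochar n) : Fin (2 * n) → ℤ) i : ℝ) = unitVec c i)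
    (a : Fin (2 * n) → ℝ) : ∑ i, |(act w a - a) i| =
      displacement c (w.right : Equiv.Perm (Fin (2 * n)))⁻¹ a := by
  simp only [displacement, Pi.sub_apply, act, h]

theorem zero_mem_closedAlcove (n : ℕ) : (0 : Fin (2 * n) → ℝ) ∈ closedAlcove n :=
  ⟨fun i => by simp, fun i j _ _ => by simp⟩

theorem sum_sq_permCochar_mu {n : ℕ} (hn : 2 ≤ n) (σ : StarPerm n) :
    ∑ i, ((permCochar σ (mu n) : Cochar n) : Fin (2 * n) → ℤ) i ^ 2 = 2 := by
  have h : ∀ c i : Fin (2 * n), unitVec c i ^ 2 = |unitVec c i| := by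
    intro c i
    simp only [unitVec]
    split_ifs <;> norm_num
  have : ((∑ i, ((permCochar σ (mu n) : Cochar n) : Fin (2 * n) → ℤ) i ^ 2 : ℤ) : ℝ) = (2 : ℤ) := by
    push_cast
    simp only [permCochar_mu_apply hn, h, sum_abs_unitVec]
  exact_mod_cast this

theorem eq_unitVec_of_sum_abs_le {n : ℕ} {ν : Cochar n} (hν : ν ≠ 0)
    (h : ∑ i, |((ν : Fin (2 * n) → ℤ) i : ℝ)| ≤ 2) :
    ∃ c, ∀ i, ((ν : Fin (2 * n) → ℤ) i : ℝ) = unitVec c i := by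
  have h : ∑ i, |(ν : Fin (2 * n) → ℤ) i| ≤ 2 := by exact_mod_cast h
  obtain ⟨c, hc⟩ : ∃ c, 0 < (ν : Fin (2 * n) → ℤ) c := by
    by_contra! hcon
    refine hν (Subtype.ext (funext fun i => ?_))
    have h1 := hcon i
    have h2 := hcon i.rev
    rw [ν.2 i] at h2
    change (ν : Fin (2 * n) → ℤ) i = 0
    omega
  have hsum := Finset.sum_add_sum_compl ({c, c.rev} : Finset (Fin (2 * n)))
    fun i => |(ν : Fin (2 * n) → ℤ) i|
  rw [Finset.sum_pair (rev_ne_self c).symm, ν.2 c, abs_neg, abs_of_pos hc] at hsum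
  have hrest : 0 ≤ ∑ i ∈ ({c, c.rev} : Finset (Fin (2 * n)))ᶜ, |(ν : Fin (2 * n) → ℤ) i| :=
    Finset.sum_nonneg fun _ _ => abs_nonneg _
  refine ⟨c, fun i => ?_⟩
  by_cases h1 : i = c
  · rw [h1, unitVec_self, show (ν : Fin (2 * n) → ℤ) c = 1 by omega, Int.cast_one]
  by_cases h2 : i = c.rev
  · rw [h2, unitVec_rev, unitVec_self, ν.2 c, show (ν : Fin (2 * n) → ℤ) c = 1 by omega]
    norm_num
  · have h3 := Finset.single_le_sum (f := fun i => |(ν : Fin (2 * n) → ℤ) i|)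
      (fun _ _ => abs_nonneg _) (show i ∈ ({c, c.rev} : Finset (Fin (2 * n)))ᶜ by simp [h1, h2])
    have h4 : |(ν : Fin (2 * n) → ℤ) i| ≤ 0 := by
      omega
    rw [unitVec_of_ne h1 h2, abs_nonpos_iff.1 h4, Int.cast_zero]

/-! ### Permissible elements and the ascent to translations -/

theorem exists_unitVec_of_mem_perm {n : ℕ} (hn : 2 ≤ n) {w : IwahoriWeyl n}
    (hw : w ∈ Perm (mu n)) :
    Equiv.Perm.sign (w.right : Equiv.Perm (Fin (2 * n)))⁻¹ = 1 ∧
    ∃ c, (∀ i, (((w.left.toAdd : Cochar n) : Fin (2 * n) → ℤ) i : ℝ) = unitVec c i) ∧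
      ∀ a ∈ closedAlcove n, displacement c (w.right : Equiv.Perm (Fin (2 * n)))⁻¹ a ≤ 2 := by
  obtain ⟨⟨hl, hr⟩, hhull⟩ := hw
  have hr' : w.right ∈ EvenStarPerm n := by
    simpa [transl] using hr
  have hsign : Equiv.Perm.sign (w.right : Equiv.Perm (Fin (2 * n)))⁻¹ = 1 := by
    rw [Equiv.Perm.sign_inv]
    exact hr'
  have hcl : ∀ a ∈ closedAlcove n, ∑ i, |(act w a - a) i| ≤ 2 := by
    intro a ha
    have hc : IsClosed {a : Fin (2 * n) → ℝ | ∑ i, |(act w a - a) i| ≤ 2} := by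
      refine isClosed_le ?_ continuous_const
      exact continuous_finsetSum _ fun i _ =>
        ((continuous_apply i).comp ((continuous_act w).sub continuous_id)).abs
    exact closure_minimal (fun a ha => sum_abs_le_of_mem_orbitHull hn (hhull a ha)) hc
      (closedAlcove_subset_closure n ha)
  have h0 := hcl 0 (zero_mem_closedAlcove n)
  simp only [Pi.sub_apply, act, Pi.zero_apply, add_zero, sub_zero] at h0
  have hν : (w.left.toAdd : Cochar n) ≠ 0 := by
    intro hν
    -- A zero translation part would put the image of `μ` in the coroot lattice, but its squared
    -- length 2 is not divisible by 4.
    have hl' : -permCochar w.right (mu n) ∈ corootLattice n := by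
      convert hl using 1
      apply Subtype.ext
      funext i
      change _ = ((w.left.toAdd + permCochar w.right (permCochar 1⁻¹ (-(mu n))) : Cochar n) :
        Fin (2 * n) → ℤ) i
      simp [permCochar, hν]
    rw [neg_mem_iff, mem_corootLattice_iff, sum_sq_permCochar_mu hn] at hl'
    omega
  obtain ⟨c, hc⟩ := eq_unitVec_of_sum_abs_le hν h0
  exact ⟨hsign, c, hc, fun a ha => by rw [← sum_abs_act_sub hc]; exact hcl a ha⟩

theorem exists_reflection {n : ℕ} {c j : Fin (2 * n)} (h1 : j ≠ c) (h2 : j ≠ c.rev) :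
    ∃ (a : AffineRoot n) (ε : ℝ), ε * ε = 1 ∧ (∀ x, a.val x = ε * (x c - x j - 1)) ∧
      (a.linearPart : Equiv.Perm (Fin (2 * n))) = doubleSwap c j := by
  rcases lt_or_gt_of_ne h1 with h | h
  · refine ⟨⟨j, c, h, fun h => h2 (by rw [h, Fin.rev_rev]), -1⟩, -1, by norm_num, fun x => ?_, ?_⟩
    · simp only [AffineRoot.val]
      push_cast
      ring
    · simp only [AffineRoot.linearPart, doubleSwap]
      rw [Equiv.swap_comm, Equiv.swap_comm j.rev]
  · refine ⟨⟨c, j, h, h2, 1⟩, 1, by norm_num, fun x => ?_, rfl⟩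
    simp only [AffineRoot.val]
    push_cast
    ring

theorem exists_reflection_mul_mem_perm {n : ℕ} (hn : 2 ≤ n) {w : IwahoriWeyl n}
    (hw : w ∈ Perm (mu n)) (hwt : ¬ IsTranslation w) :
    ∃ a : AffineRoot n, a.reflection * w ∈ Perm (mu n) ∧ (a.reflection * w).left = w.left ∧
      0 < a.val (basePoint n) * a.val (act w (basePoint n)) := by
  obtain ⟨hsign, c, hc, H⟩ := exists_unitVec_of_mem_perm hn hw
  have hτ : ∀ i, (w.right : Equiv.Perm (Fin (2 * n)))⁻¹ i.rev =
    ((w.right : Equiv.Perm (Fin (2 * n)))⁻¹ i).rev := (StarPerm n).inv_mem w.right.2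
  have hτ1 : (w.right : Equiv.Perm (Fin (2 * n)))⁻¹ ≠ 1 := by
    intro h
    refine hwt ⟨w.left.toAdd, SemidirectProduct.ext rfl (Subtype.ext ?_)⟩
    exact inv_eq_one.1 h
  obtain ⟨j, h1, h2, hside, hperm⟩ := exists_step hτ hsign hτ1 H
  obtain ⟨a, ε, hε, hval, hlin⟩ := exists_reflection h1 h2
  -- The root `x_c - x_j - 1` vanishes at `ν = w 0`, so the reflection fixes this point.
  have hleft : (a.reflection * w).left = w.left := by
    have h0 : ∀ w' : IwahoriWeyl n, act w' 0 =
        fun i => (((w'.left.toAdd : Cochar n) : Fin (2 * n) → ℤ) i : ℝ) := fun w' => by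
      funext i
      simp [act]
    have hw0 : act w 0 = unitVec c := by rw [h0]; exact funext hc
    have h3 : act (a.reflection * w) 0 = act w 0 := by
      rw [act_mul, hw0, a.act_reflection_eq (unitVec_rev c), hval, unitVec_self,
        unitVec_of_ne h1 h2]
      simp
    rw [h0, h0] at h3
    refine Multiplicative.toAdd.injective (Subtype.ext (funext fun i => ?_))
    have := congrFun h3 i
    exact_mod_cast this
  have hright : (((a.reflection * w).right : StarPerm n) : Equiv.Perm (Fin (2 * n)))⁻¹ =
      (w.right : Equiv.Perm (Fin (2 * n)))⁻¹ * doubleSwap c j := by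
    have h3 : a.linearPart * a.linearPart = 1 :=
      congrArg SemidirectProduct.right a.reflection_mul_self
    have h4 : (doubleSwap c j)⁻¹ = doubleSwap c j := by
      rw [inv_eq_iff_mul_eq_one, ← hlin]
      exact congrArg Subtype.val h3
    rw [SemidirectProduct.mul_right, Subgroup.coe_mul, mul_inv_rev]
    change _ * (a.linearPart : Equiv.Perm (Fin (2 * n)))⁻¹ = _
    rw [hlin, h4]
  refine ⟨a, ⟨?_, fun x hx => ?_⟩, hleft, ?_⟩
  · rw [mul_assoc]
    exact mul_mem a.reflection_mem hw.1
  · refine mem_orbitHull_of_sum_abs_le hn (fun i => ?_) ?_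
    · simp only [Pi.sub_apply, act_mem_V (a.reflection * w) hx.1 i, hx.1 i]
      ring
    · rw [sum_abs_act_sub (c := c) (by rw [hleft]; exact hc), hright]
      exact hperm x (alcove_subset_closedAlcove n hx)
  · have e1 : act w (basePoint n) c = 1 + basePoint n ((w.right : Equiv.Perm _)⁻¹ c) := by
      rw [act, hc, unitVec_self]
    have e2 : act w (basePoint n) j = basePoint n ((w.right : Equiv.Perm _)⁻¹ j) := by
      rw [act, hc, unitVec_of_ne h1 h2, zero_add]
    have b1 := abs_lt.1 (abs_basePoint_lt c)
    have b2 := abs_lt.1 (abs_basePoint_lt j)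
    rw [hval, hval, e1, e2, mul_mul_mul_comm, hε, one_mul]
    exact mul_pos_of_neg_of_neg (by linarith) (by linarith)

/-- The alcoves `wA` and `xA` coincide, so the side of a hyperplane can be read off from the
component in `W_a`. -/
theorem val_mul_val_pos_of_eq_mul {n : ℕ} (a : AffineRoot n) {w x ω : IwahoriWeyl n}
    (hω : ω ∈ alcoveStabilizer n) (hw : w = x * ω)
    (h : 0 < a.val (basePoint n) * a.val (act w (basePoint n))) :
    0 < a.val (basePoint n) * a.val (act x (basePoint n)) := by
  have hp := basePoint_mem_alcove n
  have hωp : act ω (basePoint n) ∈ alcove n := by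
    have : act ω '' alcove n = alcove n := hω
    rw [← this]
    exact Set.mem_image_of_mem _ hp
  have h1 := a.val_act_mul_pos x hωp hp
  rw [hw, act_mul] at h
  have h2 := mul_pos h h1
  rw [mul_assoc, ← mul_assoc (a.val (act x (act ω (basePoint n)))), mul_left_comm] at h2
  exact pos_of_mul_pos_right h2 (mul_self_nonneg _)

theorem exists_transl_bruhat {n : ℕ} (hn : 2 ≤ n) {ω : IwahoriWeyl n}
    (hω : ω ∈ alcoveStabilizer n) (x : affineWeyl n) (hx : (x : IwahoriWeyl n) * ω ∈ Perm (mu n)) :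
    ∃ ν ∈ weylOrbit (mu n), ∃ x' : affineWeyl n, transl ν = (x' : IwahoriWeyl n) * ω ∧
      CoxeterBruhatLE (simpleReflections n) x x' := by
  obtain ⟨L, hL⟩ : ∃ L, L = ((x : IwahoriWeyl n) * ω).left := ⟨_, rfl⟩
  -- Each step keeps the translation part and raises the length. With finitely many linear parts the
  -- lengths are bounded by some `B`, and induction on `B` minus the length terminates.
  have hfin : {y : affineWeyl n | ((y : IwahoriWeyl n) * ω).left = L}.Finite := by
    refine Set.Finite.of_finite_image (f := fun y => ((y : IwahoriWeyl n) * ω).right)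
      (Set.toFinite _) fun y hy z hz h => ?_
    refine Subtype.ext (mul_right_cancel (SemidirectProduct.ext (hy.trans hz.symm) h))
  obtain ⟨B, hB⟩ := (hfin.image (wordLength (simpleReflections n))).bddAbove
  obtain ⟨k, hk⟩ : ∃ k, k = B - wordLength (simpleReflections n) x := ⟨_, rfl⟩
  induction k using Nat.strong_induction_on generalizing x with
  | _ k ih =>
    by_cases ht : IsTranslation ((x : IwahoriWeyl n) * ω)
    · obtain ⟨ν, hν⟩ := ht
      obtain ⟨-, c, hc, -⟩ := exists_unitVec_of_mem_perm hn hx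
      refine ⟨ν, mem_weylOrbit_mu hn (c := c) fun i => ?_, x, hν.symm, Relation.ReflTransGen.refl⟩
      rw [← hc i, hν]
      rfl
    · obtain ⟨a, h1, h2, h3⟩ := exists_reflection_mul_mem_perm hn hx ht
      have h4 := val_mul_val_pos_of_eq_mul a hω rfl h3
      have h5 := wordLength_lt_of_same_side hn a x h4
      set x₁ : affineWeyl n := ⟨a.reflection, a.reflection_mem⟩ * x with hx₁
      have e : (x₁ : IwahoriWeyl n) * ω = a.reflection * (x * ω) := mul_assoc _ _ _
      have h6 : wordLength (simpleReflections n) x₁ ≤ B :=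
        hB ⟨x₁, by rw [Set.mem_ofPred_eq, e, h2, hL], rfl⟩
      obtain ⟨ν, hν, x', hx', hle⟩ := ih _ (by omega) x₁ (by rwa [e]) (by rw [e, h2, hL]) rfl
      exact ⟨ν, hν, x', hx', (coxeterBruhatLE_reflection_mul hn a x h4).trans hle⟩

end EvenOrthogonal

open EvenOrthogonal in
theorem mainTheorem2 (n : ℕ) (hn : 2 ≤ n) :
    (∀ w : IwahoriWeyl n, w ∈ Perm (mu n) → ¬ IsTranslation w →
      ∃ a : AffineRoot n, a.reflection * w ∈ Perm (mu n) ∧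
        BruhatLT w (a.reflection * w) ∧ (a.reflection * w).left = w.left) ∧
    Perm (mu n) ⊆ Adm (mu n) := by
  refine ⟨fun w hw hwt => ?_, fun w hw => ?_⟩
  · obtain ⟨a, h1, h2, h3⟩ := exists_reflection_mul_mem_perm hn hw hwt
    obtain ⟨x, -, ω, hω, hxω⟩ := exists_closure_mul_stabilizer hn w
    have h4 := val_mul_val_pos_of_eq_mul a hω hxω h3
    refine ⟨a, h1, ⟨⟨x, ⟨a.reflection, a.reflection_mem⟩ * x, ω, hω, hxω, ?_,
      coxeterBruhatLE_reflection_mul hn a x h4⟩, fun h => ?_⟩, h2⟩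
    · rw [hxω]
      exact (mul_assoc _ _ _).symm
    · have h5 := wordLength_lt_of_same_side hn a x h4
      rw [show (⟨a.reflection, a.reflection_mem⟩ : affineWeyl n) = 1 from
        Subtype.ext (right_eq_mul.1 h), one_mul] at h5
      exact lt_irrefl _ h5
  · obtain ⟨x, -, ω, hω, hxω⟩ := exists_closure_mul_stabilizer hn w
    obtain ⟨ν, hν, x', hx', hle⟩ := exists_transl_bruhat hn hω x (hxω ▸ hw)
    exact ⟨ν, hν, x, x', ω, hω, hxω, hx', hle⟩
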